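/- Graphs are finite, simple and undirected, and classes of graphs are closed under isomorphism. For graphs $F$ and $G$, let $\hom(F,G)$ denote the number of homomorphisms from $F$ to $G$, that is, of maps $V(F) \to V(G)$ that send every edge of $F$ to an edge of $G$. Let $\mathcal{F}$ and $\mathcal{G}$ be classes of graphs such that membership in $\mathcal{G}$ is decidable, $\mathcal{G}$ is closed under taking induced subgraphs (including the graph without vertices) and under disjoint unions, and every $F \in \mathcal{F}$ is connected (in particular non-empty). Then the following parameterised problem is fixed-parameter tractable. Input: a graph $F \in \mathcal{F}$, given by its adjacency matrix, and a number $h \in \mathbb{N} = \{0,1,2,\dots\}$, given in binary. Parameter: $|V(F)|$. Question: does there exist a graph $G \in \mathcal{G}$ with $\hom(F,G) = h$? That is, there are a deterministic (multi-stack) Turing machine, a computable function $f \colon \mathbb{N} \to \mathbb{N}$ and a polynomial $p$ such that, for every $F \in \mathcal{F}$ and $h \in \mathbb{N}$, the machine, started on the encoding of $(F,h)$, halts after at most $f(|V(F)|) \cdot p(n)$ steps, where $n$ is the length of this encoding, and answers the question correctly. Nothing is required of the machine on inputs $(F,h)$ with $F \notin \mathcal{F}$. -/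

import Mathlib

/-- A finite simple graph, given with the vertex set `{0, …, order - 1}`.
Every finite graph is isomorphic to one of these. -/
structure FinGraph where
  order : ℕ
  graph : SimpleGraph (Fin order)

namespace FinGraph

/-- The number of homomorphisms from `F` to `G`. -/
noncomputable def homCount (F G : FinGraph) : ℕ :=
  Nat.card (F.graph →g G.graph)

open Classical in
/-- A graph as a bit string: its adjacency matrix, row by row. -/
noncomputable def encode (G : FinGraph) : List Bool :=
  (List.finRange G.order ×ˢ List.finRange G.order).map
    fun p => decide (G.graph.Adj p.1 p.2)

theorem encode_injective : Function.Injective encode := by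
  rintro ⟨m, G⟩ ⟨n, H⟩ h
  have hl := congrArg List.length h
  simp only [encode, List.length_map, List.length_product, List.length_finRange] at hl
  obtain rfl : m = n := Nat.mul_self_inj.mp hl
  have hG : G = H := by
    ext i j
    simp only [encode, List.map_inj_left] at h
    have := h (i, j) (by simp)
    simpa using this
  rw [hG]

/-- An instance `(F, h)` as a string: the adjacency matrix of `F` followed by the binary
representation of `h`, the two parts being written in two disjoint copies of the alphabet `Bool`. -/
noncomputable def encodeWithNumber (x : FinGraph × ℕ) : List (Bool ⊕ Bool) :=
  x.1.encode.map Sum.inl ++ (Computability.encodeNat x.2).map Sum.inr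

theorem encodeWithNumber_injective : Function.Injective encodeWithNumber := by
  rintro ⟨F, a⟩ ⟨G, b⟩ h
  have hL : ∀ l m : List Bool, (l.map Sum.inl ++ m.map Sum.inr : List (Bool ⊕ Bool)).filterMap
      Sum.getLeft? = l := by
    simp [List.filterMap_map, Function.comp_def]
  have hR : ∀ l m : List Bool, (l.map Sum.inl ++ m.map Sum.inr : List (Bool ⊕ Bool)).filterMap
      Sum.getRight? = m := by
    simp [List.filterMap_map, Function.comp_def]
  have hl := congrArg (List.filterMap Sum.getLeft?) h
  have hr := congrArg (List.filterMap Sum.getRight?) h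
  rw [encodeWithNumber, encodeWithNumber, hL, hL] at hl
  rw [encodeWithNumber, encodeWithNumber, hR, hR] at hr
  have hab : a = b := by
    simpa using congrArg Computability.decodeNat hr
  exact Prod.ext (encode_injective hl) hab

/-- Membership in the graph class `𝒢` is decidable: the set of the adjacency matrices of its
members is a decidable set of bit strings. -/
def DecidableMembership (𝒢 : Set FinGraph) : Prop :=
  ComputablePred fun w : List Bool => ∃ G ∈ 𝒢, G.encode = w

/-- `𝒢` contains every graph that is isomorphic to an induced subgraph of a member of `𝒢`.
In particular `𝒢` is closed under isomorphism. -/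
def ClosedUnderInducedSubgraphs (𝒢 : Set FinGraph) : Prop :=
  ∀ G ∈ 𝒢, ∀ H : FinGraph, Nonempty (H.graph ↪g G.graph) → H ∈ 𝒢

/-- `𝒢` contains every graph that is isomorphic to the disjoint union of two members of `𝒢`. -/
def ClosedUnderDisjointUnions (𝒢 : Set FinGraph) : Prop :=
  ∀ G ∈ 𝒢, ∀ H ∈ 𝒢, ∀ K : FinGraph, Nonempty (K.graph ≃g G.graph ⊕g H.graph) → K ∈ 𝒢

end FinGraph

/-- A parameterized decision problem. Every instance is presented to a machine as a string over
the alphabet `Sym`. -/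
structure ParamProblem where
  Instance : Type
  Sym : Type
  encode : Instance → List Sym
  param : Instance → ℕ
  Yes : Instance → Prop

/-- Fixed-parameter tractability: there are a Turing machine (with finitely many stacks in place
of tapes, all over finite alphabets), a computable function `f` and a polynomial `p` such that
on every instance `x`, written as a string of length `n`, the machine halts after at most
`f (param x) * p n` steps and outputs the single bit that says whether `x` is a yes-instance. -/
def ParamProblem.InFPT (P : ParamProblem) : Prop :=
  ∃ (M : Turing.TM2ComputableAux P.Sym Bool) (f : ℕ → ℕ) (p : Polynomial ℕ),
    (∀ k, Finite (M.tm.Γ k)) ∧ Computable f ∧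
    ∀ x : P.Instance, ∃ b : Bool, (b = true ↔ P.Yes x) ∧
      Nonempty (Turing.TM2OutputsInTime M.tm
        ((P.encode x).map M.inputAlphabet.symm)
        (some ([b].map M.outputAlphabet.symm))
        (f (P.param x) * p.eval (P.encode x).length))

/-- The problem whose input is a graph `F ∈ 𝓕` and a natural number `h` in binary, whose
parameter is the number of vertices of `F`, and whose question is whether some `G ∈ 𝒢` has
exactly `h` homomorphisms from `F`. -/
noncomputable def pSingleHomRec (𝓕 𝒢 : Set FinGraph) : ParamProblem where
  Instance := {x : FinGraph × ℕ // x.1 ∈ 𝓕}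
  Sym := Bool ⊕ Bool
  encode x := FinGraph.encodeWithNumber x.1
  param x := x.1.1.order
  Yes x := ∃ G ∈ 𝒢, FinGraph.homCount x.1.1 G = x.1.2

/-!
Fix a connected graph `F` with `k` vertices. The values `hom(F, G)`, `G ∈ 𝒢`, form a submonoid of
`ℕ`, because for connected `F` the count is additive on disjoint unions. By inclusion-exclusion over
the possible images, `hom(F, G)` is an integer combination of the values on induced subgraphs of `G`
with at most `k` vertices, so the values on graphs of order at most `k`, all of which are at most
`k ^ k`, generate a submonoid with the same greatest common divisor. Hence membership of `h` in the
set of values is periodic in `h` beyond a threshold, with both the threshold and the period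
computable from `k`, and membership of a small number is decided by trying all graphs of bounded
order.

A machine can therefore reduce `h` while it reads the input: it remembers the adjacency matrix and
one of boundedly many residues, and at the end of the input it decides about the residue. Each of
these transitions is a computable function on a set of states that is bounded in terms of `k`; the
evaluator of partial recursive functions carries it out, in a number of steps that is again
computable.
-/

open Function

section NumericalMonoid

theorem exists_sum_mul_eq_of_setGcd_dvd {A : Finset ℕ} {x : ℕ} (hdvd : Nat.setGcd A ∣ x) :
    ∃ c : ℕ → ℤ, ∑ b ∈ A, c b * b = x := by
  have hspan : (x : ℤ) ∈ Ideal.span ((fun n : ℕ => (n : ℤ)) '' A) := by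
    rw [← Nat.span_singleton_setGcd, Ideal.mem_span_singleton]
    exact_mod_cast hdvd
  obtain ⟨c, hc⟩ := (Submodule.mem_span_image_finset_iff_exists_fun ℤ).1 hspan
  refine ⟨fun b => if hb : b ∈ A then c ⟨b, hb⟩ else 0, ?_⟩
  rw [← hc, ← Finset.sum_coe_sort]
  exact Finset.sum_congr rfl fun b _ => by simp

/-- The coefficients of a Bézout representation of `x` can be reduced modulo a nonzero generator;
the bound on `x` makes the remaining multiple of that generator nonnegative. -/
theorem mem_closure_of_setGcd_dvd {A : Finset ℕ} {B x : ℕ} (hAB : ∀ a ∈ A, a ≤ B)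
    (hdvd : Nat.setGcd A ∣ x) (hx : (B + 1) ^ 3 ≤ x) : x ∈ AddSubmonoid.closure (A : Set ℕ) := by
  obtain ⟨a, ha, ha0⟩ : ∃ a ∈ A, a ≠ 0 := by
    refine Nat.exists_ne_zero_of_setGcd_ne_zero fun h0 => ?_
    rw [h0, zero_dvd_iff] at hdvd
    exact absurd hx (by simp [hdvd])
  obtain ⟨c, hc⟩ := exists_sum_mul_eq_of_setGcd_dvd hdvd
  let n : ℕ → ℕ := fun b => (c b % a).toNat
  have hn : ∀ b, (n b : ℤ) = c b % a := fun b => Int.toNat_of_nonneg (Int.emod_nonneg _ (by simpa))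
  have hn_le : ∀ b, n b ≤ B := fun b => by
    have := Int.emod_lt_of_pos (c b) (b := a) (by omega)
    have := hAB a ha
    have := hn b
    omega
  have hsum_le : ∑ b ∈ A, n b * b ≤ x := calc
    ∑ b ∈ A, n b * b ≤ A.card • (B * B) :=
      Finset.sum_le_card_nsmul _ _ _ fun b hb => Nat.mul_le_mul (hn_le b) (hAB b hb)
    _ ≤ (B + 1) * (B * B) := Nat.mul_le_mul_right _ <| by
      simpa using Finset.card_le_card fun b hb => Finset.mem_range_succ_iff.2 (hAB b hb)
    _ ≤ (B + 1) ^ 3 := by nlinarith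
    _ ≤ x := hx
  obtain ⟨t, ht⟩ : a ∣ x - ∑ b ∈ A, n b * b := by
    zify [hsum_le]
    rw [← hc, ← Finset.sum_sub_distrib]
    refine Finset.dvd_sum fun b _ => ?_
    rw [hn, ← sub_mul]
    exact Dvd.dvd.mul_right Int.dvd_self_sub_emod _
  have mul_mem : ∀ b ∈ A, ∀ m, m * b ∈ AddSubmonoid.closure (A : Set ℕ) := fun b hb m => by
    simpa using AddSubmonoid.nsmul_mem _ (AddSubmonoid.subset_closure hb) m
  rw [← Nat.add_sub_cancel' hsum_le, ht, mul_comm]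
  exact add_mem (sum_mem fun b hb => mul_mem b hb _) (mul_mem a ha t)

theorem add_factorial_mem_iff (H : AddSubmonoid ℕ) {A : Finset ℕ} {B x : ℕ}
    (hAH : (A : Set ℕ) ⊆ H) (hAB : ∀ a ∈ A, a ≤ B) (hdvd : ∀ y ∈ H, Nat.setGcd A ∣ y)
    (hx : (B + 1) ^ 3 ≤ x) : x + B.factorial ∈ H ↔ x ∈ H := by
  have mem_iff : ∀ y, (B + 1) ^ 3 ≤ y → (y ∈ H ↔ Nat.setGcd A ∣ y) := fun y hy =>
    ⟨hdvd y, fun h => AddSubmonoid.closure_le.2 hAH (mem_closure_of_setGcd_dvd hAB h hy)⟩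
  rw [mem_iff _ hx, mem_iff _ (hx.trans (Nat.le_add_right _ _))]
  by_cases h0 : Nat.setGcd (A : Set ℕ) = 0
  · have : 0 < (B + 1) ^ 3 := by positivity
    have := B.factorial_pos
    rw [h0, zero_dvd_iff, zero_dvd_iff]
    omega
  · obtain ⟨a, ha, ha0⟩ := Nat.exists_ne_zero_of_setGcd_ne_zero h0
    exact Nat.dvd_add_left <| (Nat.setGcd_dvd_of_mem ha).trans <|
      Nat.dvd_factorial (Nat.pos_of_ne_zero ha0) (hAB a ha)

end NumericalMonoid

section Homomorphisms

variable {U V W : Type*} {F : SimpleGraph U} {G : SimpleGraph V} {H : SimpleGraph W}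

theorem isLeft_hom_sum_apply_eq (hF : F.Preconnected) (f : F →g G ⊕g H) (u v : U) :
    (f u).isLeft = (f v).isLeft := by
  have hr : (G ⊕g H).Reachable (f u) (f v) := (hF u v).map f
  rcases hu : f u with x | x <;> rcases hv : f v with y | y <;> rw [hu, hv] at hr
  · rfl
  · exact (SimpleGraph.not_reachable_sum_inl_inr _ _ hr).elim
  · exact (SimpleGraph.not_reachable_sum_inl_inr _ _ hr.symm).elim
  · rfl

theorem exists_comp_eq_of_connected (hF : F.Connected) (f : F →g G ⊕g H) :
    (∃ g : F →g G, SimpleGraph.Embedding.sumInl.toHom.comp g = f) ∨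
      ∃ g : F →g H, SimpleGraph.Embedding.sumInr.toHom.comp g = f := by
  obtain ⟨u⟩ := hF.nonempty
  have hf := isLeft_hom_sum_apply_eq hF.preconnected f u
  rcases hu : f u with x | x <;> simp only [hu, Sum.isLeft_inl, Sum.isLeft_inr] at hf
  · choose g hg using fun v => Sum.isLeft_iff.1 (hf v).symm
    exact .inl ⟨⟨g, fun h => by simpa [hg] using f.map_adj h⟩, by ext v; exact (hg v).symm⟩
  · choose g hg using fun v => Sum.isRight_iff.1 (Sum.isLeft_eq_false.1 (hf v).symm)
    exact .inr ⟨⟨g, fun h => by simpa [hg] using f.map_adj h⟩, by ext v; exact (hg v).symm⟩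

theorem card_hom_sum_of_connected [Finite U] [Finite V] [Finite W] (hF : F.Connected) :
    Nat.card (F →g G ⊕g H) = Nat.card (F →g G) + Nat.card (F →g H) := by
  have : Finite (F →g G) := Finite.of_injective _ DFunLike.coe_injective
  have : Finite (F →g H) := Finite.of_injective _ DFunLike.coe_injective
  obtain ⟨u⟩ := hF.nonempty
  let inl := (SimpleGraph.Embedding.sumInl (G := G) (H := H)).toHom
  let inr := (SimpleGraph.Embedding.sumInr (G := G) (H := H)).toHom
  have inl_injective : Injective (inl.comp : (F →g G) → (F →g G ⊕g H)) := fun g g' h =>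
    DFunLike.ext _ _ fun v => Sum.inl_injective (DFunLike.congr_fun h v)
  have inr_injective : Injective (inr.comp : (F →g H) → (F →g G ⊕g H)) := fun g g' h =>
    DFunLike.ext _ _ fun v => Sum.inr_injective (DFunLike.congr_fun h v)
  have inl_ne_inr (g : F →g G) (g' : F →g H) : inl.comp g ≠ inr.comp g' := fun h =>
    Sum.inl_ne_inr (DFunLike.congr_fun h u)
  rw [← Nat.card_sum]
  refine (Nat.card_eq_of_bijective (Sum.elim inl.comp inr.comp)
    ⟨inl_injective.sumElim inr_injective inl_ne_inr, fun f => ?_⟩).symm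
  rcases exists_comp_eq_of_connected hF f with ⟨g, hg⟩ | ⟨g, hg⟩
  · exact ⟨Sum.inl g, hg⟩
  · exact ⟨Sum.inr g, hg⟩

theorem card_hom_induce_eq (F : SimpleGraph U) (G : SimpleGraph V) (s : Set V) :
    Nat.card (F →g G.induce s) = Nat.card {f : F →g G // Set.range f ⊆ s} :=
  Nat.card_congr
    { toFun g := ⟨(SimpleGraph.Embedding.induce s).toHom.comp g,
        Set.range_subset_iff.2 fun u => (g u).2⟩
      invFun f := ⟨fun u => ⟨f.1 u, f.2 ⟨u, rfl⟩⟩, fun {_ _} h => f.1.map_adj h⟩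
      left_inv _ := rfl
      right_inv _ := rfl }

theorem card_hom_induce_eq_sum [Finite U] [Finite V] (F : SimpleGraph U) (G : SimpleGraph V)
    (s : Finset V) :
    Nat.card (F →g G.induce (s : Set V)) =
      ∑ t ∈ s.powerset, Nat.card {f : F →g G // Set.range f = t} := by
  classical
  have := Fintype.ofFinite U
  have : Finite (F →g G) := Finite.of_injective _ DFunLike.coe_injective
  have := Fintype.ofFinite (F →g G)
  have range_eq (f : F →g G) : Set.range f = (Finset.univ.image f : Finset V) := by simp
  rw [card_hom_induce_eq]
  simp only [Nat.card_eq_fintype_card, Fintype.card_subtype, range_eq,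
    Finset.coe_subset, Finset.coe_inj]
  rw [Finset.card_eq_sum_card_fiberwise (f := fun f : F →g G => Finset.univ.image f)
    (t := s.powerset) fun f hf => Finset.mem_powerset.2 (Finset.mem_filter.1 hf).2]
  refine Finset.sum_congr rfl fun t ht => congrArg Finset.card ?_
  ext f
  simp only [Finset.mem_filter, Finset.mem_univ, true_and, and_iff_right_iff_imp]
  rintro rfl
  exact Finset.mem_powerset.1 ht

theorem dvd_card_hom_range_eq [Finite U] [Finite V] {d : ℕ}
    (hd : ∀ s : Finset V, s.card ≤ Nat.card U → d ∣ Nat.card (F →g G.induce (s : Set V)))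
    (s : Finset V) : d ∣ Nat.card {f : F →g G // Set.range f = s} := by
  classical
  induction s using Finset.strongInduction with
  | H s ih =>
    by_cases hs : s.card ≤ Nat.card U
    · have hsum := hd s hs
      rw [card_hom_induce_eq_sum, ← Finset.add_sum_erase _ _ (Finset.mem_powerset_self s)] at hsum
      refine (Nat.dvd_add_left (Finset.dvd_sum fun t ht => ih t ?_)).1 hsum
      rw [Finset.mem_erase, Finset.mem_powerset] at ht
      exact Finset.ssubset_iff_subset_ne.2 ⟨ht.2, ht.1⟩
    · have : IsEmpty {f : F →g G // Set.range f = s} := ⟨fun ⟨f, hf⟩ => hs <| by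
        simpa [hf] using Finite.card_range_le f⟩
      simp

theorem dvd_card_hom_of_forall_induce [Finite U] [Finite V] {d : ℕ}
    (hd : ∀ s : Finset V, s.card ≤ Nat.card U → d ∣ Nat.card (F →g G.induce (s : Set V))) :
    d ∣ Nat.card (F →g G) := by
  have := Fintype.ofFinite V
  have hsum := card_hom_induce_eq_sum F G Finset.univ
  rw [card_hom_induce_eq, Nat.card_congr (Equiv.subtypeUnivEquiv (by simp))] at hsum
  exact hsum ▸ Finset.dvd_sum fun t _ => dvd_card_hom_range_eq hd t

theorem exists_card_hom_induce_eq [Finite U] [Finite V] (F : SimpleGraph U) (G : SimpleGraph V) :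
    ∃ s : Finset V, s.card ≤ Nat.card (F →g G) * Nat.card U ∧
      Nat.card (F →g G.induce (s : Set V)) = Nat.card (F →g G) := by
  classical
  have := Fintype.ofFinite U
  have : Finite (F →g G) := Finite.of_injective _ DFunLike.coe_injective
  have := Fintype.ofFinite (F →g G)
  refine ⟨Finset.univ.biUnion fun f : F →g G => Finset.univ.image f, ?_, ?_⟩
  · simpa using Finset.card_biUnion_le_card_mul Finset.univ
      (fun f : F →g G => Finset.univ.image f) _ fun f _ => Finset.card_image_le
  · rw [card_hom_induce_eq]
    exact Nat.card_congr <| Equiv.subtypeUnivEquiv fun f => by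
      rw [Finset.coe_biUnion]
      refine subset_trans ?_ (Set.subset_biUnion_of_mem (Finset.mem_coe.2 (Finset.mem_univ f)))
      simp

end Homomorphisms

namespace FinGraph

theorem homCount_eq_of_iso (F : FinGraph) {G : FinGraph} {V : Type*} {H : SimpleGraph V}
    (e : G.graph ≃g H) : F.homCount G = Nat.card (F.graph →g H) :=
  Nat.card_congr (SimpleGraph.Iso.homCongr .refl e)

theorem homCount_le (F G : FinGraph) : F.homCount G ≤ G.order ^ F.order := by
  simpa [homCount] using Nat.card_le_card_of_injective
    (fun f : F.graph →g G.graph => (f : Fin _ → Fin _)) DFunLike.coe_injective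

/-- The subgraph induced by a set of vertices, with its vertices renumbered. -/
noncomputable def induce (G : FinGraph) (s : Finset (Fin G.order)) : FinGraph :=
  ⟨s.card, (G.graph.induce (s : Set (Fin G.order))).overFin (by simp)⟩

theorem homCount_induce (F G : FinGraph) (s : Finset (Fin G.order)) :
    F.homCount (G.induce s) = Nat.card (F.graph →g G.graph.induce (s : Set (Fin G.order))) :=
  homCount_eq_of_iso F (SimpleGraph.overFinIso _ _).symm

/-- The numbers of homomorphisms from `F` to the members of a graph class. -/
def homValues (F : FinGraph) (𝒢 : Set FinGraph) : Set ℕ :=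
  {h | ∃ G ∈ 𝒢, F.homCount G = h}

variable {F : FinGraph} {𝒢 : Set FinGraph}

theorem ClosedUnderInducedSubgraphs.induce_mem (hI : ClosedUnderInducedSubgraphs 𝒢)
    {G : FinGraph} (hG : G ∈ 𝒢) (s : Finset (Fin G.order)) : G.induce s ∈ 𝒢 :=
  hI G hG _ ⟨(SimpleGraph.Embedding.induce _).comp (SimpleGraph.overFinIso _ _).symm.toEmbedding⟩

theorem exists_order_le_of_mem_homValues (hI : ClosedUnderInducedSubgraphs 𝒢) {h : ℕ}
    (hh : h ∈ F.homValues 𝒢) : ∃ G ∈ 𝒢, G.order ≤ h * F.order ∧ F.homCount G = h := by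
  obtain ⟨G, hG, rfl⟩ := hh
  obtain ⟨s, hs, hcard⟩ := exists_card_hom_induce_eq F.graph G.graph
  refine ⟨G.induce s, hI.induce_mem hG s, ?_, (homCount_induce F G s).trans hcard⟩
  simpa [homCount, induce] using hs

theorem zero_mem_homValues (hF : F.graph.Connected) (hI : ClosedUnderInducedSubgraphs 𝒢)
    (hne : 𝒢.Nonempty) : 0 ∈ F.homValues 𝒢 := by
  obtain ⟨G, hG⟩ := hne
  obtain ⟨u⟩ := hF.nonempty
  refine ⟨G.induce ∅, hI.induce_mem hG _, ?_⟩
  rw [homCount_induce, Nat.card_eq_zero]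
  exact .inl ⟨fun f => by simpa using (f u).2⟩

theorem add_mem_homValues (hF : F.graph.Connected) (hU : ClosedUnderDisjointUnions 𝒢) {a b : ℕ}
    (ha : a ∈ F.homValues 𝒢) (hb : b ∈ F.homValues 𝒢) : a + b ∈ F.homValues 𝒢 := by
  obtain ⟨G, hG, rfl⟩ := ha
  obtain ⟨H, hH, rfl⟩ := hb
  let K : FinGraph := ⟨G.order + H.order, (G.graph ⊕g H.graph).overFin (by simp)⟩
  have e : K.graph ≃g G.graph ⊕g H.graph := (SimpleGraph.overFinIso _ _).symm
  exact ⟨K, hU G hG H hH K ⟨e⟩,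
    (homCount_eq_of_iso F e).trans (card_hom_sum_of_connected hF)⟩

/-- The numerical monoid formed by the numbers of homomorphisms from a connected graph to the
members of a nonempty class closed under induced subgraphs and disjoint unions. -/
def homSubmonoid (hF : F.graph.Connected) (hI : ClosedUnderInducedSubgraphs 𝒢)
    (hU : ClosedUnderDisjointUnions 𝒢) (hne : 𝒢.Nonempty) : AddSubmonoid ℕ where
  carrier := F.homValues 𝒢
  zero_mem' := zero_mem_homValues hF hI hne
  add_mem' := add_mem_homValues hF hU

/-- A threshold beyond which the numbers of homomorphisms from a connected graph of order `k` to
the members of a closed class form a periodic set. -/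
def threshold (k : ℕ) : ℕ := (k ^ k + 1) ^ 3

/-- A period, not depending on the closed class, of the set of numbers of homomorphisms from a
connected graph of order `k`. -/
def period (k : ℕ) : ℕ := (k ^ k).factorial

open Classical in
/-- The numbers of homomorphisms from `F` to the members of `𝒢` that are not larger than `F`. -/
noncomputable def smallHomValues (F : FinGraph) (𝒢 : Set FinGraph) : Finset ℕ :=
  {h ∈ Finset.range (F.order ^ F.order + 1) | ∃ G ∈ 𝒢, G.order ≤ F.order ∧ F.homCount G = h}

theorem mem_smallHomValues {h : ℕ} :
    h ∈ F.smallHomValues 𝒢 ↔ ∃ G ∈ 𝒢, G.order ≤ F.order ∧ F.homCount G = h := by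
  simp only [smallHomValues, Finset.mem_filter, Finset.mem_range, and_iff_right_iff_imp]
  rintro ⟨G, -, hG, rfl⟩
  exact Nat.lt_succ_of_le ((homCount_le F G).trans (Nat.pow_le_pow_left hG _))

theorem setGcd_smallHomValues_dvd (hI : ClosedUnderInducedSubgraphs 𝒢) {h : ℕ}
    (hh : h ∈ F.homValues 𝒢) : Nat.setGcd (F.smallHomValues 𝒢) ∣ h := by
  obtain ⟨G, hG, rfl⟩ := hh
  refine dvd_card_hom_of_forall_induce fun s hs => Nat.setGcd_dvd_of_mem ?_
  rw [← homCount_induce]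
  exact mem_smallHomValues.2 ⟨_, hI.induce_mem hG s, by simpa [induce] using hs, rfl⟩

theorem add_period_mem_homValues_iff (hF : F.graph.Connected)
    (hI : ClosedUnderInducedSubgraphs 𝒢) (hU : ClosedUnderDisjointUnions 𝒢) {h : ℕ}
    (hh : threshold F.order ≤ h) :
    h + period F.order ∈ F.homValues 𝒢 ↔ h ∈ F.homValues 𝒢 := by
  rcases 𝒢.eq_empty_or_nonempty with rfl | hne
  · simp [homValues]
  refine add_factorial_mem_iff (homSubmonoid hF hI hU hne) (A := F.smallHomValues 𝒢)
    (fun a ha => ?_) (fun a ha => ?_) (fun y hy => setGcd_smallHomValues_dvd hI hy) hh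
  · obtain ⟨G, hG, -, rfl⟩ := mem_smallHomValues.1 ha
    exact ⟨G, hG, rfl⟩
  · obtain ⟨G, -, hG, rfl⟩ := mem_smallHomValues.1 ha
    exact (homCount_le F G).trans (Nat.pow_le_pow_left hG _)

end FinGraph

section EventualMod

/-- The representative below `N + p` of `x` in the quotient of `ℕ` that identifies every `y ≥ N`
with `y + p`. -/
def eventualMod (N p x : ℕ) : ℕ :=
  if x < N then x else N + (x - N) % p

variable {N p : ℕ}

theorem eventualMod_of_lt {x : ℕ} (hx : x < N) : eventualMod N p x = x :=
  if_pos hx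

theorem eventualMod_lt (hp : 0 < p) (x : ℕ) : eventualMod N p x < N + p := by
  have := Nat.mod_lt (x - N) hp
  unfold eventualMod
  split_ifs <;> omega

theorem eventualMod_add_mul {x : ℕ} (hx : N ≤ x) (t : ℕ) :
    eventualMod N p (x + t * p) = eventualMod N p x := by
  rw [eventualMod, eventualMod, if_neg (by omega), if_neg (by omega), Nat.sub_add_comm hx,
    Nat.add_mul_mod_self_right]

theorem exists_eq_eventualMod_add_mul {x : ℕ} (hx : N ≤ x) :
    N ≤ eventualMod N p x ∧ ∃ t, x = eventualMod N p x + t * p := by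
  have h := Nat.mod_add_div' (x - N) p
  rw [eventualMod, if_neg (by omega)]
  exact ⟨by omega, (x - N) / p, by omega⟩

theorem eventualMod_eventualMod_add (x y : ℕ) :
    eventualMod N p (eventualMod N p x + y) = eventualMod N p (x + y) := by
  rcases lt_or_ge x N with hx | hx
  · rw [eventualMod_of_lt hx]
  · obtain ⟨hN, t, ht⟩ := exists_eq_eventualMod_add_mul (p := p) hx
    conv_rhs => rw [ht]
    rw [add_right_comm, eventualMod_add_mul (by omega)]

theorem eventualMod_add_eventualMod (x y : ℕ) :
    eventualMod N p (x + eventualMod N p y) = eventualMod N p (x + y) := by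
  rw [add_comm, eventualMod_eventualMod_add, add_comm]

theorem eventualMod_eventualMod (x : ℕ) :
    eventualMod N p (eventualMod N p x) = eventualMod N p x :=
  eventualMod_eventualMod_add x 0

theorem eventualMod_mem_iff {A : Set ℕ} (hA : ∀ x, N ≤ x → (x + p ∈ A ↔ x ∈ A)) (x : ℕ) :
    eventualMod N p x ∈ A ↔ x ∈ A := by
  rcases lt_or_ge x N with hx | hx
  · rw [eventualMod_of_lt hx]
  · obtain ⟨hN, t, ht⟩ := exists_eq_eventualMod_add_mul (p := p) hx
    have add_mul_mem_iff (t : ℕ) : eventualMod N p x + t * p ∈ A ↔ eventualMod N p x ∈ A := by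
      induction t with
      | zero => simp
      | succ t ih => rw [Nat.succ_mul, ← add_assoc, hA _ (by omega), ih]
    conv_rhs => rw [ht]
    exact (add_mul_mem_iff t).symm

/-- The value of a binary numeral, read from the least significant digit on, in the quotient
described by `eventualMod N p`: the place value of the next digit and the value of the digits
read so far are updated by one digit. -/
def eventualModDigit (N p : ℕ) (q : ℕ × ℕ) (b : Bool) : ℕ × ℕ :=
  (eventualMod N p (q.1 + q.1), eventualMod N p (q.2 + bif b then q.1 else 0))

theorem foldl_eventualModDigit (v : List Bool) (x y : ℕ) :
    v.foldl (eventualModDigit N p) (eventualMod N p x, eventualMod N p y) =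
      (eventualMod N p (2 ^ v.length * x),
        eventualMod N p (y + Nat.ofDigits 2 (v.map Bool.toNat) * x)) := by
  induction v generalizing x y with
  | nil => simp
  | cons b v ih =>
    have digit : eventualModDigit N p (eventualMod N p x, eventualMod N p y) b =
        (eventualMod N p (x + x), eventualMod N p (y + b.toNat * x)) := by
      cases b <;> simp [eventualModDigit, eventualMod_eventualMod_add,
        eventualMod_add_eventualMod, eventualMod_eventualMod]
    rw [List.foldl_cons, digit, ih, List.length_cons, List.map_cons, Nat.ofDigits_cons]
    ring_nf

end EventualMod

theorem ofDigits_encodeNat (n : ℕ) :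
    Nat.ofDigits 2 ((Computability.encodeNat n).map Bool.toNat) = n := by
  have ofDigits_encodePosNum (m : PosNum) :
      Nat.ofDigits 2 ((Computability.encodePosNum m).map Bool.toNat) = (m : ℕ) := by
    induction m with
    | one => simp [Computability.encodePosNum]
    | bit0 m ih =>
      rw [Computability.encodePosNum, List.map_cons, Nat.ofDigits_cons, ih, PosNum.cast_bit0]
      simp [two_mul]
    | bit1 m ih =>
      rw [Computability.encodePosNum, List.map_cons, Nat.ofDigits_cons, ih, PosNum.cast_bit1]
      simp [two_mul, add_comm]
  conv_rhs => rw [← Num.to_of_nat n]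
  rw [Computability.encodeNat]
  rcases (n : Num) with _ | m
  · simp [Computability.encodeNum]
  · exact ofDigits_encodePosNum m

section Computability

theorem primrec_nat_pow : Primrec₂ ((· ^ ·) : ℕ → ℕ → ℕ) :=
  Primrec₂.unpaired'.1 Nat.Primrec.pow

theorem primrec_nat_factorial : Primrec Nat.factorial := by
  refine (Primrec.nat_rec₁ (f := fun n x => (n + 1) * x) 1 ?_).of_eq fun n => ?_
  · exact Primrec.nat_mul.comp₂ (Primrec.succ.comp₂ Primrec₂.left) Primrec₂.right
  · induction n with
    | zero => rfl
    | succ n ih => rw [Nat.factorial_succ, ← ih]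

theorem primrec_eventualMod :
    Primrec fun a : ℕ × ℕ × ℕ => eventualMod a.1 a.2.1 a.2.2 := by
  open Primrec in
  have hp : Primrec fun a : ℕ × ℕ × ℕ => a.2.1 := fst.comp snd
  have hx : Primrec fun a : ℕ × ℕ × ℕ => a.2.2 := snd.comp snd
  exact ite (nat_lt.comp hx fst) hx
    (nat_add.comp fst (nat_mod.comp (nat_sub.comp hx fst) hp))

variable {α β σ : Type*} [Primcodable α] [Primcodable β] [Primcodable σ]

theorem primrec_nat_count {R : α → ℕ → Prop} [DecidableRel R] (hR : PrimrecRel R) {f : α → ℕ}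
    (hf : Primrec f) : Primrec fun a => Nat.count (R a) (f a) := by
  open Primrec in
  have hstep : Primrec₂ fun (a : α) (p : ℕ × ℕ) => p.2 + if R a p.1 then 1 else 0 :=
    nat_add.comp (snd.comp snd) (ite (hR.comp fst (fst.comp snd)) (const 1) (const 0))
  refine (nat_rec' hf (const 0) hstep).of_eq fun a => ?_
  induction f a with
  | zero => simp
  | succ n ih => rw [Nat.count_succ, ← ih]

theorem primrecPred_forall_lt {R : α → ℕ → Prop} (hR : PrimrecRel R) {f : α → ℕ}
    (hf : Primrec f) : PrimrecPred fun a => ∀ n < f a, R a n := by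
  have hflip : PrimrecRel fun n a => R a n := hR.comp Primrec.snd Primrec.fst
  exact (hflip.forall_mem_list.comp (Primrec.list_range.comp hf) Primrec.id).of_eq fun a => by
    simp only [List.mem_range, id]

theorem primrec₂_of_forall_finite [Finite β] {f : α → β → σ} (hf : ∀ b, Primrec (f · b)) :
    Primrec₂ f := by
  obtain ⟨n, ⟨e⟩⟩ := Finite.exists_equiv_fin β
  have hfin : Primrec₂ fun (i : Fin n) a => f a (e.symm i) :=
    Primrec.fin_curry₁.2 fun i => hf (e.symm i)
  have hcomp : Primrec fun y : α × β => f y.1 (e.symm (e y.2)) :=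
    hfin.comp ((Primrec.dom_finite e).comp Primrec.snd) Primrec.fst
  exact hcomp.of_eq fun y => by rw [e.symm_apply_apply]

theorem computable_foldl {f : α → List β} {g : α → σ} {h : α → σ × β → σ} (hf : Computable f)
    (hg : Computable g) (hh : Computable₂ h) :
    Computable fun a => (f a).foldl (fun s b => h a (s, b)) (g a) := by
  open Computable in
  have hstep : Computable₂ fun (a : α) (p : ℕ × σ) =>
      ((f a)[p.1]?.casesOn p.2 fun b => h a (p.2, b) : σ) :=
    option_casesOn (list_getElem?.comp (hf.comp fst) (fst.comp snd)) (snd.comp snd)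
      (hh.comp (fst.comp fst) (pair (snd.comp (snd.comp fst)) snd))
  have foldl_take (a : α) (n : ℕ) :
      (n.rec (g a) fun m s => ((f a)[m]?.casesOn s fun b => h a (s, b) : σ)) =
        ((f a).take n).foldl (fun s b => h a (s, b)) (g a) := by
    induction n with
    | zero => rfl
    | succ n ih =>
      rw [List.take_add_one, List.foldl_append, ← ih]
      rcases hn : (f a)[n]? with _ | b <;> simp only [hn, Option.toList] <;> rfl
  refine (nat_rec (list_length.comp hf) hg hstep).of_eq fun a => ?_
  rw [foldl_take, List.take_length]

theorem computable_list_any {f : α → List β} {p : α → β → Bool} (hf : Computable f)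
    (hp : Computable₂ p) : Computable fun a => (f a).any (p a) := by
  open Computable in
  have hstep : Computable₂ fun (a : α) (y : Bool × β) => (y.1 || p a y.2) :=
    Primrec.or.to_comp.comp (fst.comp snd) (hp.comp fst (snd.comp snd))
  refine (computable_foldl hf (const false) hstep).of_eq fun a => ?_
  have foldl_or (l : List β) (y : Bool) :
      l.foldl (fun y b => y || p a b) y = (y || l.any (p a)) := by
    induction l generalizing y with
    | nil => simp
    | cons b l ih => rw [List.foldl_cons, ih, List.any_cons, Bool.or_assoc]
  exact foldl_or (f a) false

theorem computable_list_sum_map {f : α → List β} {g : α → β → ℕ} (hf : Computable f)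
    (hg : Computable₂ g) : Computable fun a => ((f a).map (g a)).sum := by
  open Computable in
  have hstep : Computable₂ fun (a : α) (y : ℕ × β) => y.1 + g a y.2 :=
    Primrec.nat_add.to_comp.comp (fst.comp snd) (hg.comp fst (snd.comp snd))
  refine (computable_foldl hf (const 0) hstep).of_eq fun a => ?_
  rw [List.sum_eq_foldl, List.foldl_map]

end Computability

section BitStrings

/-- All bit strings of length at most `n`. -/
def bitStrings : ℕ → List (List Bool)
  | 0 => [[]]
  | n + 1 => [] :: ((bitStrings n).map (List.cons false) ++ (bitStrings n).map (List.cons true))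

theorem mem_bitStrings {n : ℕ} {w : List Bool} : w ∈ bitStrings n ↔ w.length ≤ n := by
  induction n generalizing w with
  | zero => simp [bitStrings]
  | succ n ih =>
    rcases w with _ | ⟨b, w⟩
    · simp [bitStrings]
    · cases b <;> simp [bitStrings, ih]

theorem primrec_bitStrings : Primrec bitStrings := by
  open Primrec in
  have hcons (b : Bool) : Primrec₂ fun (_ : ℕ × List (List Bool)) (w : List Bool) => b :: w :=
    list_cons.comp (const b) snd
  have hstep : Primrec₂ fun (_ : ℕ) (l : List (List Bool)) =>
      [] :: (l.map (List.cons false) ++ l.map (List.cons true)) :=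
    list_cons.comp (const [])
      (list_append.comp (list_map snd (hcons false)) (list_map snd (hcons true)))
  refine (nat_rec₁ [[]] hstep).of_eq fun n => ?_
  induction n with
  | zero => rfl
  | succ n ih => rw [bitStrings, ← ih]

theorem primrec_sqrt_length : Primrec fun u : List Bool => u.length.sqrt :=
  Primrec.nat_sqrt.comp Primrec.list_length

end BitStrings

theorem product_finRange (m n : ℕ) :
    List.finRange m ×ˢ List.finRange n =
      List.ofFn (finProdFinEquiv.symm : Fin (m * n) → Fin m × Fin n) := by
  rw [List.ofFn_mul, List.ofFn_eq_map, ← List.flatMap_def]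
  refine List.flatMap_congr fun i _ => ?_
  rw [List.ofFn_eq_map]
  refine List.map_congr_left fun j _ => ?_
  rw [Equiv.eq_symm_apply]
  ext
  simp [mul_comm, add_comm]

namespace FinGraph

theorem length_encode (G : FinGraph) : G.encode.length = G.order * G.order := by
  simp [encode, List.length_product]

theorem sqrt_length_encode (G : FinGraph) : G.encode.length.sqrt = G.order := by
  rw [length_encode, Nat.sqrt_eq]

/-- The entry in row `i` and column `j` of the square matrix that is written, row by row, as the
bit string `u`. -/
def adjBit (u : List Bool) (i j : ℕ) : Bool :=
  u.getD (i * u.length.sqrt + j) false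

theorem adjBit_encode (G : FinGraph) (i j : Fin G.order) :
    adjBit G.encode i j = true ↔ G.graph.Adj i j := by
  have hindex : (i * G.encode.length.sqrt + j : ℕ) = (finProdFinEquiv (i, j) : ℕ) := by
    rw [sqrt_length_encode, finProdFinEquiv_apply_val, mul_comm, add_comm]
  have hlt : (finProdFinEquiv (i, j) : ℕ) < G.encode.length :=
    (finProdFinEquiv (i, j)).2.trans_eq G.length_encode.symm
  rw [adjBit, hindex, List.getD_eq_getElem _ _ hlt]
  simp only [encode, product_finRange, List.getElem_map, List.getElem_ofFn, Fin.eta,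
    Equiv.symm_apply_apply, decide_eq_true_eq]

/-- Whether the base-`√|w|` digits of `c` are the values of a homomorphism between the graphs with
adjacency matrices `u` and `w`. -/
def IsHomCode (u w : List Bool) (c : ℕ) : Prop :=
  ∀ i < u.length.sqrt, ∀ j < u.length.sqrt, adjBit u i j = true →
    adjBit w (c / w.length.sqrt ^ i % w.length.sqrt) (c / w.length.sqrt ^ j % w.length.sqrt) = true

instance (u w : List Bool) : DecidablePred (IsHomCode u w) := fun _ => by
  unfold IsHomCode
  infer_instance

theorem isHomCode_encode_iff (F G : FinGraph) (c : Fin (G.order ^ F.order)) :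
    IsHomCode F.encode G.encode c ↔ ∀ i j, F.graph.Adj i j →
      G.graph.Adj (finFunctionFinEquiv.symm c i) (finFunctionFinEquiv.symm c j) := by
  simp only [← adjBit_encode, finFunctionFinEquiv_symm_apply_val, IsHomCode, Fin.forall_iff,
    sqrt_length_encode]

theorem count_isHomCode_encode (F G : FinGraph) :
    Nat.count (IsHomCode F.encode G.encode) (G.order ^ F.order) = F.homCount G := by
  let : Fintype {c // c < G.order ^ F.order ∧ IsHomCode F.encode G.encode c} :=
    Nat.CountSet.fintype _ _
  rw [Nat.count_eq_card_fintype, ← Nat.card_eq_fintype_card, homCount]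
  refine (Nat.card_congr ?_).symm
  calc (F.graph →g G.graph)
      ≃ {φ : Fin F.order → Fin G.order // ∀ i j, F.graph.Adj i j → G.graph.Adj (φ i) (φ j)} :=
        ⟨fun φ => ⟨φ, fun _ _ h => φ.map_adj h⟩, fun φ => ⟨φ.1, fun {_ _} h => φ.2 _ _ h⟩,
          fun _ => rfl, fun _ => rfl⟩
    _ ≃ {c : Fin (G.order ^ F.order) // IsHomCode F.encode G.encode c} :=
        (finFunctionFinEquiv.symm.subtypeEquiv fun c => isHomCode_encode_iff F G c).symm
    _ ≃ {c : ℕ // c < G.order ^ F.order ∧ IsHomCode F.encode G.encode c} :=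
        ⟨fun c => ⟨c.1, c.1.2, c.2⟩, fun c => ⟨⟨c.1, c.2.1⟩, c.2.2⟩, fun _ => rfl, fun _ => rfl⟩

theorem primrec_adjBit : Primrec fun a : List Bool × ℕ × ℕ => adjBit a.1 a.2.1 a.2.2 := by
  open Primrec in
  exact (list_getD false).comp fst
    (nat_add.comp (nat_mul.comp (fst.comp snd) (primrec_sqrt_length.comp fst)) (snd.comp snd))

theorem primrecRel_isHomCode :
    PrimrecRel fun (a : List Bool × List Bool) (c : ℕ) => IsHomCode a.1 a.2 c := by
  open Primrec in
  let ρ := (((List Bool × List Bool) × ℕ) × ℕ) × ℕ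
  have hu : Primrec fun x : (List Bool × List Bool) × ℕ => x.1.1 := fst.comp fst
  have hw : Primrec fun x : ρ => x.1.1.1.2 := snd.comp (fst.comp (fst.comp fst))
  have hm : Primrec fun x : ρ => x.1.1.1.2.length.sqrt := primrec_sqrt_length.comp hw
  have hi : Primrec fun x : ρ => x.1.2 := snd.comp fst
  have hdigit {f : ρ → ℕ} (hf : Primrec f) :
      Primrec fun x : ρ => x.1.1.2 / x.1.1.1.2.length.sqrt ^ f x % x.1.1.1.2.length.sqrt :=
    nat_mod.comp (nat_div.comp (snd.comp (fst.comp fst)) (primrec_nat_pow.comp hm hf)) hm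
  have hedge : PrimrecRel fun (x : ((List Bool × List Bool) × ℕ) × ℕ) (j : ℕ) =>
      adjBit x.1.1.1 x.2 j = true → adjBit x.1.1.2
        (x.1.2 / x.1.1.2.length.sqrt ^ x.2 % x.1.1.2.length.sqrt)
        (x.1.2 / x.1.1.2.length.sqrt ^ j % x.1.1.2.length.sqrt) = true :=
    ((Primrec.eq.comp (primrec_adjBit.comp ((hu.comp (fst.comp fst)).pair (hi.pair snd)))
        (const true)).not.or
      (Primrec.eq.comp (primrec_adjBit.comp (hw.pair ((hdigit hi).pair (hdigit snd))))
        (const true))).of_eq fun _ => imp_iff_not_or.symm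
  have hk : Primrec fun x : (List Bool × List Bool) × ℕ => x.1.1.length.sqrt :=
    primrec_sqrt_length.comp hu
  refine primrecPred_forall_lt (R := fun x i => ∀ j < x.1.1.length.sqrt, _) ?_ hk
  exact primrecPred_forall_lt hedge (hk.comp fst)

/-- The number of homomorphisms between the graphs with adjacency matrices `u` and `w`. -/
def homCountBits (u w : List Bool) : ℕ :=
  Nat.count (IsHomCode u w) (w.length.sqrt ^ u.length.sqrt)

theorem homCountBits_encode (F G : FinGraph) : homCountBits F.encode G.encode = F.homCount G := by
  rw [homCountBits, sqrt_length_encode, sqrt_length_encode, count_isHomCode_encode]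

theorem primrec_homCountBits : Primrec₂ homCountBits :=
  primrec_nat_count primrecRel_isHomCode <| primrec_nat_pow.comp
    (primrec_sqrt_length.comp Primrec.snd) (primrec_sqrt_length.comp Primrec.fst)

theorem exists_computable_homValues {𝒢 : Set FinGraph} (hD : DecidableMembership 𝒢)
    (hI : ClosedUnderInducedSubgraphs 𝒢) :
    ∃ D : List Bool → ℕ → Bool, Computable₂ D ∧
      ∀ F h, D (encode F) h = true ↔ h ∈ F.homValues 𝒢 := by
  obtain ⟨_, hmem⟩ := hD
  let mem (w : List Bool) : Bool := decide (∃ G ∈ 𝒢, G.encode = w)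
  have hmem : Computable mem := hmem
  have hcount : PrimrecRel fun (a : List Bool × ℕ) w => homCountBits a.1 w = a.2 :=
    Primrec.eq.comp₂ (primrec_homCountBits.comp₂ (Primrec.fst.comp₂ Primrec₂.left) Primrec₂.right)
      (Primrec.snd.comp₂ Primrec₂.left)
  have hwitness : Computable₂ fun (a : List Bool × ℕ) w =>
      (mem w && decide (homCountBits a.1 w = a.2)) :=
    Primrec.and.to_comp.comp (hmem.comp Computable.snd) hcount.decide.to_comp
  have hcandidates : Primrec fun a : List Bool × ℕ =>
      bitStrings ((a.2 * a.1.length.sqrt) * (a.2 * a.1.length.sqrt)) := by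
    have hk : Primrec fun a : List Bool × ℕ => a.2 * a.1.length.sqrt :=
      Primrec.nat_mul.comp Primrec.snd (primrec_sqrt_length.comp Primrec.fst)
    exact primrec_bitStrings.comp (Primrec.nat_mul.comp hk hk)
  refine ⟨fun u h => (bitStrings ((h * u.length.sqrt) * (h * u.length.sqrt))).any fun w =>
    mem w && decide (homCountBits u w = h),
    computable_list_any hcandidates.to_comp hwitness, fun F h => ?_⟩
  simp only [List.any_eq_true, mem_bitStrings, sqrt_length_encode, mem, Bool.and_eq_true,
    decide_eq_true_eq]
  constructor
  · rintro ⟨_, -, ⟨G, hG, rfl⟩, hcount⟩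
    exact ⟨G, hG, by rw [← homCountBits_encode, hcount]⟩
  · intro hh
    obtain ⟨G, hG, hle, hcount⟩ := exists_order_le_of_mem_homValues hI hh
    refine ⟨G.encode, ?_, ⟨G, hG, rfl⟩, by rw [homCountBits_encode, hcount]⟩
    rw [length_encode]
    exact Nat.mul_self_le_mul_self hle

end FinGraph

namespace FinGraph

theorem period_pos (k : ℕ) : 0 < period k :=
  Nat.factorial_pos _

theorem one_lt_threshold (k : ℕ) : 1 < threshold k := by
  have : 0 < k ^ k := Nat.pow_self_pos
  exact Nat.one_lt_pow three_ne_zero (by omega)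

theorem primrec_threshold : Primrec threshold :=
  primrec_nat_pow.comp (Primrec.succ.comp (primrec_nat_pow.comp Primrec.id Primrec.id))
    (Primrec.const 3)

theorem primrec_period : Primrec period :=
  primrec_nat_factorial.comp (primrec_nat_pow.comp Primrec.id Primrec.id)

/-- One step of reading an instance `(F, h)` from left to right. A state holds the part of the
adjacency matrix read so far and, modulo `period k` beyond `threshold k` for the order `k` of `F`,
the place value of the next binary digit of `h` and the value of the digits read so far. -/
def readSymbol (s : List Bool × ℕ × ℕ) : Bool ⊕ Bool → List Bool × ℕ × ℕ
  | .inl b => (s.1 ++ [b], s.2)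
  | .inr b => (s.1, eventualModDigit (threshold s.1.length.sqrt) (period s.1.length.sqrt) s.2 b)

theorem foldl_readSymbol_map_inl (u w : List Bool) (q : ℕ × ℕ) :
    (w.map Sum.inl).foldl readSymbol (u, q) = (u ++ w, q) := by
  induction w generalizing u with
  | nil => simp
  | cons b w ih => rw [List.map_cons, List.foldl_cons, readSymbol, ih, List.append_assoc]; rfl

theorem foldl_readSymbol_map_inr (u v : List Bool) (q : ℕ × ℕ) :
    (v.map Sum.inr).foldl readSymbol (u, q) =
      (u, v.foldl (eventualModDigit (threshold u.length.sqrt) (period u.length.sqrt)) q) := by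
  induction v generalizing q with
  | nil => rfl
  | cons b v ih => rw [List.map_cons, List.foldl_cons, readSymbol, ih, List.foldl_cons]

theorem foldl_readSymbol (w v : List Bool) :
    (w.map Sum.inl ++ v.map Sum.inr).foldl readSymbol ([], 1, 0) =
      (w, eventualMod (threshold w.length.sqrt) (period w.length.sqrt) (2 ^ v.length),
        eventualMod (threshold w.length.sqrt) (period w.length.sqrt)
          (Nat.ofDigits 2 (v.map Bool.toNat))) := by
  have one_lt := one_lt_threshold w.length.sqrt
  have hfold := foldl_eventualModDigit (N := threshold w.length.sqrt) (p := period w.length.sqrt)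
    v 1 0
  rw [eventualMod_of_lt one_lt, eventualMod_of_lt (one_lt.trans' one_pos), mul_one, mul_one,
    zero_add] at hfold
  rw [List.foldl_append, foldl_readSymbol_map_inl, List.nil_append, foldl_readSymbol_map_inr, hfold]

theorem foldl_readSymbol_encodeWithNumber (F : FinGraph) (h : ℕ) :
    ∃ x, (encodeWithNumber (F, h)).foldl readSymbol ([], 1, 0) =
      (F.encode, x, eventualMod (threshold F.order) (period F.order) h) := by
  rw [encodeWithNumber, foldl_readSymbol, ofDigits_encodeNat, sqrt_length_encode]
  exact ⟨_, rfl⟩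

theorem primrec_readSymbol : Primrec₂ readSymbol := by
  open Primrec in
  have hinl (b : Bool) : Primrec fun s : List Bool × ℕ × ℕ => readSymbol s (.inl b) :=
    (list_append.comp fst (const [b])).pair snd
  have hinr (b : Bool) : Primrec fun s : List Bool × ℕ × ℕ => readSymbol s (.inr b) := by
    have hk : Primrec fun s : List Bool × ℕ × ℕ => s.1.length.sqrt := primrec_sqrt_length.comp fst
    have hmod {f : List Bool × ℕ × ℕ → ℕ} (hf : Primrec f) :
        Primrec fun s => eventualMod (threshold s.1.length.sqrt) (period s.1.length.sqrt) (f s) :=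
      primrec_eventualMod.comp ((primrec_threshold.comp hk).pair ((primrec_period.comp hk).pair hf))
    have hplace : Primrec fun s : List Bool × ℕ × ℕ => s.2.1 := fst.comp snd
    have hdigit : Primrec fun s : List Bool × ℕ × ℕ => bif b then s.2.1 else 0 :=
      cond (const b) hplace (const 0)
    exact fst.pair ((hmod (nat_add.comp hplace hplace)).pair
      (hmod (nat_add.comp (snd.comp snd) hdigit)))
  exact primrec₂_of_forall_finite (Sum.forall.2 ⟨hinl, hinr⟩)

/-- A list of states of `readSymbol` that contains all those reached on instances `(F, h)` in which
`F` has order `k`. -/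
def readStates (k : ℕ) : List (List Bool × ℕ × ℕ) :=
  (bitStrings (k * k)).flatMap fun u =>
    (List.range (threshold u.length.sqrt + period u.length.sqrt)).flatMap fun x =>
      (List.range (threshold u.length.sqrt + period u.length.sqrt)).map fun y => (u, x, y)

theorem primrec_readStates : Primrec readStates := by
  open Primrec in
  have hrange : Primrec fun u : List Bool =>
      List.range (threshold u.length.sqrt + period u.length.sqrt) :=
    list_range.comp (nat_add.comp (primrec_threshold.comp primrec_sqrt_length)
      (primrec_period.comp primrec_sqrt_length))
  have htriple : Primrec₂ fun (a : (ℕ × List Bool) × ℕ) (y : ℕ) => (a.1.2, a.2, y) :=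
    (snd.comp (fst.comp fst)).pair ((snd.comp fst).pair snd)
  exact list_flatMap (primrec_bitStrings.comp (nat_mul.comp Primrec.id Primrec.id))
    (list_flatMap (hrange.comp snd) (list_map (hrange.comp (snd.comp fst)) htriple))

theorem foldl_readSymbol_mem_readStates {F : FinGraph} {h : ℕ} {w : List (Bool ⊕ Bool)}
    (hw : w <+: encodeWithNumber (F, h)) :
    w.foldl readSymbol ([], 1, 0) ∈ readStates F.order := by
  obtain ⟨u, v, hu, rfl⟩ : ∃ u v : List Bool, u <+: F.encode ∧
      w = u.map Sum.inl ++ v.map Sum.inr := by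
    rcases List.prefix_or_prefix_of_prefix hw (List.prefix_append _ _) with hw' | ⟨w', rfl⟩
    · obtain ⟨u, hu, rfl⟩ := List.prefix_map_iff.1 hw'
      exact ⟨u, [], hu, by simp⟩
    · obtain ⟨v, -, rfl⟩ := List.prefix_map_iff.1 ((List.prefix_append_right_inj _).1 hw)
      exact ⟨F.encode, v, List.prefix_rfl, rfl⟩
  have hlen : u.length ≤ F.order * F.order := hu.length_le.trans_eq F.length_encode
  rw [foldl_readSymbol]
  simp only [readStates, List.mem_flatMap, List.mem_map, List.mem_range, mem_bitStrings]
  exact ⟨u, hlen, _, eventualMod_lt (period_pos _) _, _, eventualMod_lt (period_pos _) _, rfl⟩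

end FinGraph

section Runs

variable {σ τ : Type*}

/-- `f` leads from `a` to `b` in exactly `n` steps. -/
def StepsTo (f : σ → Option σ) (n : ℕ) (a b : σ) : Prop :=
  (flip bind f)^[n] (some a) = some b

namespace StepsTo

variable {f : σ → Option σ} {m n : ℕ} {a b c : σ}

theorem refl (f : σ → Option σ) (a : σ) : StepsTo f 0 a a :=
  rfl

theorem head (hab : f a = some b) (hbc : StepsTo f n b c) : StepsTo f (n + 1) a c :=
  (congrArg (flip bind f)^[n] hab).trans hbc

theorem single (hab : f a = some b) : StepsTo f 1 a b :=
  head hab (refl f b)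

theorem trans (hab : StepsTo f m a b) (hbc : StepsTo f n b c) : StepsTo f (n + m) a c := by
  rw [StepsTo, iterate_add_apply, hab, hbc]

theorem iterate_succ_eq_none (hab : StepsTo f n a b) (hb : f b = none) :
    (flip bind f)^[n + 1] (some a) = none := by
  rw [iterate_succ_apply', hab]
  exact hb

theorem iterate_ne_none (hab : StepsTo f n a b) (hmn : m ≤ n) :
    (flip bind f)^[m] (some a) ≠ none := by
  obtain ⟨k, rfl⟩ := Nat.exists_eq_add_of_le' hmn
  intro hm
  rw [StepsTo, iterate_add_apply, hm, iterate_fixed rfl] at hab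
  cases hab

theorem map {g : τ → Option τ} {φ : σ → τ} {I : Set σ}
    (hI : ∀ a ∈ I, ∀ b ∈ f a, b ∈ I) (hφ : ∀ a ∈ I, ∀ b ∈ f a, g (φ a) = some (φ b))
    (ha : a ∈ I) (hab : StepsTo f n a b) : StepsTo g n (φ a) (φ b) := by
  induction n generalizing a with
  | zero =>
    cases hab
    exact refl g _
  | succ n ih =>
    rcases hfa : f a with _ | c
    · exact absurd hfa (hab.iterate_ne_none (m := 1) (by omega))
    · have hcb : StepsTo f n c b := (congrArg (flip bind f)^[n] hfa).symm.trans hab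
      exact head (hφ a ha c hfa) (ih (hI a ha c hfa) hcb)

end StepsTo

theorem exists_stepsTo_of_reaches {f : σ → Option σ} {a b : σ}
    (h : StateTransition.Reaches f a b) : ∃ n, StepsTo f n a b := by
  induction h using Relation.ReflTransGen.head_induction_on with
  | refl => exact ⟨0, .refl f b⟩
  | head hac _ ih =>
    obtain ⟨n, hn⟩ := ih
    exact ⟨n + 1, .head hac hn⟩

theorem computable_of_stepsTo_of_halted {α σ : Type*} [Primcodable α] [Primcodable σ]
    {f : σ → Option σ} (hf : Computable f) {init final : α → σ} (hinit : Computable init)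
    {t : α → ℕ} (ht : ∀ a, StepsTo f (t a) (init a) (final a)) (hfinal : ∀ a, f (final a) = none) :
    Computable t := by
  open Computable in
  have hiterate : Computable₂ fun a n => (flip bind f)^[n] (some (init a)) := by
    have hstep : Computable₂ fun (_ : α × ℕ) (y : ℕ × Option σ) => y.2.bind f :=
      option_bind (snd.comp snd) (hf.comp snd).to₂
    refine (nat_rec snd (option_some.comp (hinit.comp fst)) hstep).of_eq fun ⟨a, n⟩ => ?_
    induction n with
    | zero => rfl
    | succ n ih =>
      exact (congrArg (Option.bind · f) ih).trans
        (iterate_succ_apply' (flip bind f) n (some (init a))).symm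
  have hhalted : Computable₂ fun a n => ((flip bind f)^[n + 1] (some (init a))).isNone :=
    (Primrec.dom_bool not).to_comp.comp
      (Primrec.option_isSome.to_comp.comp (hiterate.comp fst (succ.comp snd))) |>.of_eq
      fun a => Option.not_isSome _
  refine (Partrec.rfind (p := fun a n =>
    (Part.some ((flip bind f)^[n + 1] (some (init a))).isNone : Part Bool))
    hhalted.partrec).of_eq_tot fun a => Nat.mem_rfind.2 ⟨?_, fun {m} hm => ?_⟩
  · exact Part.mem_some_iff.2 (Option.isNone_iff_eq_none.2
      ((ht a).iterate_succ_eq_none (hfinal a))).symm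
  · exact Part.mem_some_iff.2 (Option.isNone_eq_false_iff.2
      (Option.isSome_iff_ne_none.2 ((ht a).iterate_ne_none hm))).symm

end Runs

section Coding

/-- The coding of the elements of a finite type that lists them in some arbitrary order. -/
noncomputable abbrev primcodableOfFintype (α : Type*) [Fintype α] : Primcodable α :=
  .ofEquiv (Fin (Fintype.card α)) (Fintype.equivFin α)

/-- Functions on a finite type are coded as the tuples of their values. -/
noncomputable abbrev primcodablePi (K β : Type*) [Fintype K] [Primcodable β] :
    Primcodable (K → β) :=
  .ofEquiv (Fin (Fintype.card K) → β) (Equiv.arrowCongr (Fintype.equivFin K) (Equiv.refl β))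

attribute [local instance] primcodablePi

variable {α β K : Type*} [Primcodable α] [Primcodable β] [Fintype K]

theorem primrec_apply (k : K) : Primrec fun T : K → β => T k := by
  let e := Equiv.arrowCongr (Fintype.equivFin K) (Equiv.refl β)
  have happly : Primrec fun T : K → β => e T (Fintype.equivFin K k) :=
    Primrec.fin_app.comp Primrec.of_equiv (.const _)
  exact happly.of_eq fun T => congrArg T ((Fintype.equivFin K).symm_apply_apply k)

theorem primrec_pi {f : α → K → β} (hf : ∀ k, Primrec fun a => f a k) : Primrec f := by
  let e := Equiv.arrowCongr (Fintype.equivFin K) (Equiv.refl β)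
  refine (Primrec.of_equiv_iff e).1 (Primrec.fin_curry.2 ?_)
  exact (Primrec.fin_curry₁.2 fun i => hf ((Fintype.equivFin K).symm i)).swap

theorem primrec_update [DecidableEq K] {T : α → K → β} (hT : Primrec T) (k : K) {b : α → β}
    (hb : Primrec b) : Primrec fun a => update (T a) k (b a) := by
  refine primrec_pi fun k' => ?_
  rcases eq_or_ne k' k with rfl | h
  · exact hb.of_eq fun a => (update_self k' (b a) (T a)).symm
  · exact ((primrec_apply k').comp hT).of_eq fun a => (update_of_ne h (b a) (T a)).symm

end Coding

section CodedConfigurations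

open Turing

/-- The configurations of a machine, halted or with a label in the set `S`. -/
def supportedCfgs {K Λ : Type*} {Γ : K → Type*} {σ : Type*} (S : Finset Λ) :
    Set (TM2.Cfg Γ Λ σ) :=
  {c | c.l ∈ Finset.insertNone S}

theorem step_mem_supportedCfgs {K Λ : Type*} [DecidableEq K] {Γ : K → Type*} {σ : Type*}
    {S : Finset Λ} {M : Λ → TM2.Stmt Γ Λ σ} (hS : ∀ q ∈ S, TM2.SupportsStmt S (M q)) :
    ∀ a ∈ supportedCfgs S, ∀ b ∈ TM2.step M a, b ∈ supportedCfgs S := by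
  rintro ⟨_ | q, v, T⟩ ha b hb
  · cases hb
  · have hq : q ∈ S := Finset.some_mem_insertNone.1 ha
    exact @TM2.step_supports _ _ _ _ ⟨q⟩ _ M S ⟨hq, hS⟩ _ _ hb ha

variable {K Γ Λ σ : Type*} [DecidableEq Λ] (S : Finset Λ)

/-- A label as an element of the set `S`; labels outside `S` have no such representation. -/
def restrictLabel (q : Λ) : Option S :=
  if h : q ∈ S then some ⟨q, h⟩ else none

theorem restrictLabel_of_mem {q : Λ} (hq : q ∈ S) : restrictLabel S q = some ⟨q, hq⟩ :=
  dif_pos hq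

/-- A configuration of a machine with labels in the finite set `S`, as a tuple of data that can be
coded. -/
def codeCfg (c : TM2.Cfg (fun _ : K => Γ) Λ σ) : Option S × σ × (K → List Γ) :=
  (c.l.bind (restrictLabel S), c.var, c.stk)

variable [DecidableEq K]

/-- One step of a machine on coded configurations. -/
def codedStep (M : Λ → TM2.Stmt (fun _ : K => Γ) Λ σ) (x : Option S × σ × (K → List Γ)) :
    Option (Option S × σ × (K → List Γ)) :=
  x.1.map fun q : S => codeCfg S (TM2.stepAux (M q) x.2.1 x.2.2)

variable {S} {M : Λ → TM2.Stmt (fun _ : K => Γ) Λ σ}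

theorem codedStep_codeCfg :
    ∀ a ∈ supportedCfgs S, ∀ b ∈ TM2.step M a,
      codedStep S M (codeCfg S a) = some (codeCfg S b) := by
  rintro ⟨_ | q, v, T⟩ ha b hb
  · cases hb
  · have hq : restrictLabel S q = some ⟨q, _⟩ :=
      restrictLabel_of_mem S (Finset.some_mem_insertNone.1 ha)
    cases hb
    simp only [codedStep, codeCfg, Option.bind_some, hq, Option.map_some]

attribute [local instance] primcodablePi

variable [Fintype K] [Primcodable Γ] [Finite Γ] [Primcodable σ] [Finite σ] [Primcodable S]

theorem primrec_codeCfg_stepAux (q : TM2.Stmt (fun _ : K => Γ) Λ σ) :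
    Primrec fun y : σ × (K → List Γ) => codeCfg S (TM2.stepAux q y.1 y.2) := by
  open Primrec in
  have hget (k : K) : Primrec fun y : σ × (K → List Γ) => y.2 k := (primrec_apply k).comp snd
  have hread (f : σ → Option Γ → σ) (k : K) :
      Primrec fun y : σ × (K → List Γ) => f y.1 (y.2 k).head? :=
    (dom_finite (uncurry f)).comp (pair fst (list_head?.comp (hget k)))
  induction q with
  | push k f q ih =>
    exact ih.comp (pair fst (primrec_update snd k
      (list_cons.comp ((dom_finite f).comp fst) (hget k))))
  | peek k f q ih => exact ih.comp (pair (hread f k) snd)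
  | pop k f q ih =>
    exact ih.comp (pair (hread f k) (primrec_update snd k (list_tail.comp (hget k))))
  | load f q ih => exact ih.comp (pair ((dom_finite f).comp fst) snd)
  | branch f q₁ q₂ ih₁ ih₂ =>
    refine (cond ((dom_finite f).comp fst) ih₁ ih₂).of_eq fun y => ?_
    rw [TM2.stepAux]
    cases f y.1 <;> rfl
  | goto l => exact pair ((dom_finite fun v => restrictLabel S (l v)).comp fst) Primrec.id
  | halt => exact pair (const none) Primrec.id

theorem primrec_codedStep : Primrec (codedStep S M) := by
  have hstep : Primrec₂ fun (x : Option S × σ × (K → List Γ)) (q : S) =>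
      codeCfg S (TM2.stepAux (M q) x.2.1 x.2.2) :=
    primrec₂_of_forall_finite fun q => (primrec_codeCfg_stepAux (M q)).comp Primrec.snd
  exact Primrec.option_map Primrec.fst hstep

theorem computable_of_stepsTo_step {α : Type*} [Primcodable α]
    (hS : ∀ q ∈ S, TM2.SupportsStmt S (M q)) {init final : α → TM2.Cfg (fun _ : K => Γ) Λ σ}
    (hinit : Computable fun a => codeCfg S (init a))
    (hl : ∀ a, init a ∈ supportedCfgs S) {t : α → ℕ}
    (ht : ∀ a, StepsTo (TM2.step M) (t a) (init a) (final a)) (hfinal : ∀ a, (final a).l = none) :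
    Computable t := by
  refine computable_of_stepsTo_of_halted primrec_codedStep.to_comp hinit
    (final := fun a => codeCfg S (final a))
    (fun a => (ht a).map (step_mem_supportedCfgs hS) codedStep_codeCfg (hl a)) fun a => ?_
  simp only [codedStep, codeCfg, hfinal a, Option.bind_none, Option.map_none]

end CodedConfigurations

section Evaluator

open Turing Turing.PartrecToTM2 Turing.ToPartrec

theorem trNat_bit (b : Bool) (n : ℕ) (h : n ≠ 0 ∨ b = true) :
    trNat (Nat.bit b n) = (bif b then Γ'.bit1 else Γ'.bit0) :: trNat n := by
  have hc : ((Nat.bit b n : ℕ) : Num) = bif b then Num.bit1 (n : Num) else Num.bit0 (n : Num) := by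
    rw [← Num.ofNat'_eq, Num.ofNat'_bit, ← Num.ofNat'_eq]
    cases b <;> rfl
  rw [trNat, hc, trNat]
  have hn : (n : Num) = 0 → n = 0 := fun h0 => by exact_mod_cast h0
  rcases hm : (n : Num) with _ | m
  · cases b
    · simp [hn hm] at h
    · rfl
  · cases b <;> rfl

theorem trNat_eq_cons {n : ℕ} (h : n ≠ 0) :
    trNat n = (bif n.bodd then Γ'.bit1 else Γ'.bit0) :: trNat n.div2 := by
  have hbit : n.div2 ≠ 0 ∨ n.bodd = true := by
    by_contra! hc
    exact h (by rw [← Nat.bit_bodd_div2 n, hc.1, Bool.eq_false_iff.2 hc.2, Nat.bit_false_zero])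
  exact (congrArg trNat (Nat.bit_bodd_div2 n)).symm.trans (trNat_bit _ _ hbit)

instance : Fintype K' :=
  ⟨{.main, .rev, .aux, .stack}, fun k => by cases k <;> simp⟩

noncomputable instance : Primcodable Γ' :=
  primcodableOfFintype Γ'

theorem primrec_trNat : Primrec trNat := by
  have hlength : Primrec fun p : Unit × List (List Γ') => p.2.length :=
    Primrec.list_length.comp Primrec.snd
  have hstep : Primrec₂ fun (_ : Unit) (l : List (List Γ')) =>
      if l.length = 0 then some [] else
        l[l.length.div2]?.map fun w => (bif l.length.bodd then Γ'.bit1 else Γ'.bit0) :: w := by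
    refine Primrec.ite (Primrec.eq.comp hlength (Primrec.const 0)) (Primrec.const _) ?_
    exact Primrec.option_map
      (Primrec.list_getElem?.comp Primrec.snd (Primrec.nat_div2.comp hlength))
      (Primrec.list_cons.comp (Primrec.cond (Primrec.nat_bodd.comp (hlength.comp Primrec.fst))
        (Primrec.const _) (Primrec.const _)) Primrec.snd)
  have hrec := Primrec.nat_strong_rec (fun (_ : Unit) n => trNat n) hstep fun _ n => by
    by_cases hn : n = 0
    · simp [hn]
    · have hlt : n.div2 < n := Nat.binaryRec_decreasing hn
      simp [hn, hlt, trNat_eq_cons hn]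
  exact hrec.comp (Primrec.const ()) Primrec.id

theorem exists_code_eval {α β : Type*} [Primcodable α] [Primcodable β] {f : α → β → ℕ}
    (hf : Computable₂ f) :
    ∃ c : Code, ∀ a b, c.eval [Encodable.encode a, Encodable.encode b] = pure [f a b] := by
  open Computable in
  let g (m n : ℕ) : ℕ :=
    (((Encodable.decode m : Option α).bind fun a =>
      (Encodable.decode n : Option β).map (f a))).getD 0
  have hmap : Computable₂ fun (p : ℕ × ℕ) (a : α) =>
      (Encodable.decode p.2 : Option β).map (f a) :=
    option_map (Computable.decode.comp (snd.comp fst)) (hf.comp (snd.comp fst) snd).to₂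
  have hg : Computable₂ g :=
    option_getD (option_bind (Computable.decode.comp fst) hmap) (Computable.const 0)
  obtain ⟨c, hc⟩ := Code.exists_code (Nat.Partrec'.part_iff₂.2 hg.partrec₂)
  refine ⟨c, fun a b => (hc ⟨[Encodable.encode a, Encodable.encode b], rfl⟩).trans ?_⟩
  have hgab : g (Encodable.encode a) (Encodable.encode b) = f a b := by
    simp only [g, Encodable.encodek, Option.bind_some, Option.map_some, Option.getD_some]
  rw [← hgab]
  exact Part.map_some _ _

theorem mem_eval_halt {c : Code} {v w : List ℕ} (h : c.eval v = pure w) :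
    PartrecToTM2.halt w ∈ StateTransition.eval (TM2.step tr) (PartrecToTM2.init c v) := by
  rw [tr_eval, h]
  exact Part.mem_map _ (Part.mem_some w)

attribute [local instance] primcodablePi

/-- The configuration in which the evaluator of partial recursive functions starts at the label
`q₀` on the arguments `v`. -/
def evaluatorInit (q₀ : Λ') (v : List ℕ) : TM2.Cfg (fun _ : K' => Γ') Λ' (Option Γ') :=
  ⟨some q₀, none, K'.elim (trList v) [] [] []⟩

theorem primrec_codeCfg_evaluatorInit (S : Finset Λ') [Primcodable S] (q₀ : Λ') :
    Primrec₂ fun m n : ℕ => codeCfg S (evaluatorInit q₀ [m, n]) := by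
  open Primrec in
  have hmain : Primrec fun p : ℕ × ℕ => trList [p.1, p.2] :=
    list_append.comp (primrec_trNat.comp fst) (list_cons.comp (const _)
      (list_append.comp (primrec_trNat.comp snd) (const _)))
  have hstacks : Primrec fun p : ℕ × ℕ => K'.elim (trList [p.1, p.2]) [] [] [] :=
    primrec_pi fun k => by
      cases k
      · exact hmain
      all_goals exact const []
  exact pair (const _) (pair (const none) hstacks)

/-- The evaluator needs a number of steps that is itself a computable function of the arguments:
its configurations can be coded, so it can be run until it halts. -/
theorem exists_evaluator {α β : Type*} [Primcodable α] [Primcodable β] {f : α → β → ℕ}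
    (hf : Computable₂ f) :
    ∃ (S : Finset Λ') (q₀ : Λ') (t : α → β → ℕ), q₀ ∈ S ∧
      (∀ q ∈ S, TM2.SupportsStmt S (tr q)) ∧ Computable₂ t ∧
      ∀ a b, StepsTo (TM2.step tr) (t a b)
        (evaluatorInit q₀ [Encodable.encode a, Encodable.encode b])
        (PartrecToTM2.halt [f a b]) := by
  obtain ⟨c, hc⟩ := exists_code_eval hf
  obtain ⟨hq₀, hS⟩ := tr_supports c Cont'.halt
  set S := codeSupp c Cont'.halt
  set q₀ := trNormal c Cont'.halt
  have hrun (a : α) (b : β) := exists_stepsTo_of_reaches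
    (StateTransition.mem_eval.1 (mem_eval_halt (hc a b))).1
  choose t ht using hrun
  let _ : Primcodable S := primcodableOfFintype S
  refine ⟨S, q₀, t, hq₀, hS, ?_, ht⟩
  refine computable_of_stepsTo_step hS (init := fun p : α × β =>
      evaluatorInit q₀ [Encodable.encode p.1, Encodable.encode p.2]) ?_
    (fun _ => Finset.some_mem_insertNone.2 hq₀) (fun p => ht p.1 p.2) fun _ => rfl
  exact (primrec_codeCfg_evaluatorInit S q₀).to_comp.comp
    (Computable.encode.comp Computable.fst) (Computable.encode.comp Computable.snd)

end Evaluator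

section Embedding

open Turing

universe u

variable {K K₂ Λ Λ₂ σ τ : Type*} {Γ : K → Type u} {Γ₂ : K₂ → Type u}

/-- A statement as part of the program of a machine with further stacks, labels and variables;
`relabel` renames the labels, and instead of halting the program goes to the label that `onHalt`
reads off the further variable. -/
def embedStmt (relabel : Λ → Λ₂) (onHalt : τ → Λ₂) :
    TM2.Stmt Γ Λ σ → TM2.Stmt (Sum.elim Γ Γ₂) Λ₂ (σ × τ)
  | .push k f q => .push (.inl k) (fun v => f v.1) (embedStmt relabel onHalt q)
  | .peek k f q => .peek (.inl k) (fun v a => (f v.1 a, v.2)) (embedStmt relabel onHalt q)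
  | .pop k f q => .pop (.inl k) (fun v a => (f v.1 a, v.2)) (embedStmt relabel onHalt q)
  | .load f q => .load (fun v => (f v.1, v.2)) (embedStmt relabel onHalt q)
  | .branch f q₁ q₂ =>
    .branch (fun v => f v.1) (embedStmt relabel onHalt q₁) (embedStmt relabel onHalt q₂)
  | .goto l => .goto fun v => relabel (l v.1)
  | .halt => .goto fun v => onHalt v.2

/-- The contents of two families of stacks. -/
abbrev joinStacks (T : ∀ k, List (Γ k)) (U : ∀ k, List (Γ₂ k)) (k : K ⊕ K₂) :
    List (Sum.elim Γ Γ₂ k) :=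
  k.rec T U

/-- A configuration of a machine as a configuration of a machine that runs it as in `embedStmt`,
with `w` in the further variable and `U` on the further stacks. -/
def embedCfg (relabel : Λ → Λ₂) (onHalt : τ → Λ₂) (w : τ) (U : ∀ k, List (Γ₂ k))
    (c : TM2.Cfg Γ Λ σ) : TM2.Cfg (Sum.elim Γ Γ₂) Λ₂ (σ × τ) :=
  ⟨some (c.l.elim (onHalt w) relabel), (c.var, w), joinStacks c.stk U⟩

variable [DecidableEq K] [DecidableEq K₂]

theorem update_joinStacks_inl (T : ∀ k, List (Γ k)) (U : ∀ k, List (Γ₂ k)) (k : K)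
    (L : List (Γ k)) : update (joinStacks T U) (.inl k) L = joinStacks (update T k L) U :=
  (Sum.rec_update_left (γ := fun k => List (Sum.elim Γ Γ₂ k)) T U k L).symm

theorem update_joinStacks_inr (T : ∀ k, List (Γ k)) (U : ∀ k, List (Γ₂ k)) (k : K₂)
    (L : List (Γ₂ k)) : update (joinStacks T U) (.inr k) L = joinStacks T (update U k L) :=
  (Sum.rec_update_right (γ := fun k => List (Sum.elim Γ Γ₂ k)) T U k L).symm

theorem stepAux_embedStmt (relabel : Λ → Λ₂) (onHalt : τ → Λ₂) (q : TM2.Stmt Γ Λ σ) (v : σ) (w : τ)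
    (T : ∀ k, List (Γ k)) (U : ∀ k, List (Γ₂ k)) :
    TM2.stepAux (embedStmt relabel onHalt q) (v, w) (joinStacks T U) =
      embedCfg relabel onHalt w U (TM2.stepAux q v T) := by
  induction q generalizing v T with
  | push k f q ih =>
    exact (congrArg (TM2.stepAux (embedStmt relabel onHalt q) (v, w))
      (update_joinStacks_inl T U k (f v :: T k))).trans (ih v _)
  | peek k f _ ih => exact ih _ T
  | pop k f q ih =>
    exact (congrArg (TM2.stepAux (embedStmt relabel onHalt q) (f v (T k).head?, w))
      (update_joinStacks_inl T U k (T k).tail)).trans (ih _ _)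
  | load f _ ih => exact ih _ T
  | branch f q₁ q₂ ih₁ ih₂ =>
    rw [embedStmt, TM2.stepAux, TM2.stepAux]
    cases f v
    · exact ih₂ v T
    · exact ih₁ v T
  | goto l => rfl
  | halt => rfl

theorem stepsTo_embedCfg {S : Finset Λ} {M : Λ → TM2.Stmt Γ Λ σ}
    (hS : ∀ q ∈ S, TM2.SupportsStmt S (M q)) {relabel : Λ → Λ₂} {onHalt : τ → Λ₂}
    {M₂ : Λ₂ → TM2.Stmt (Sum.elim Γ Γ₂) Λ₂ (σ × τ)}
    (hM : ∀ q ∈ S, M₂ (relabel q) = embedStmt relabel onHalt (M q)) (w : τ)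
    (U : ∀ k, List (Γ₂ k)) {n : ℕ} {a b : TM2.Cfg Γ Λ σ}
    (ha : a ∈ supportedCfgs S) (hab : StepsTo (TM2.step M) n a b) :
    StepsTo (TM2.step M₂) n (embedCfg relabel onHalt w U a) (embedCfg relabel onHalt w U b) := by
  refine hab.map (step_mem_supportedCfgs hS) ?_ ha
  rintro ⟨_ | q, v, T⟩ ha b hb
  · cases hb
  · cases hb
    exact congrArg some ((congrArg (TM2.stepAux · (v, w) (joinStacks T U))
      (hM q (Finset.some_mem_insertNone.1 ha))).trans (stepAux_embedStmt relabel onHalt _ v w T U))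

end Embedding

section PushAll

open Turing

variable {K Λ σ : Type*} {Γ : K → Type*}

/-- The statement that puts the word `l` on the stack `k` and continues with `q`. -/
def pushAll (k : K) (l : List (Γ k)) (q : TM2.Stmt Γ Λ σ) : TM2.Stmt Γ Λ σ :=
  l.foldl (fun q a => .push k (fun _ => a) q) q

theorem stepAux_pushAll [DecidableEq K] (k : K) (l : List (Γ k)) (q : TM2.Stmt Γ Λ σ) (v : σ)
    (T : ∀ k, List (Γ k)) :
    TM2.stepAux (pushAll k l q) v T = TM2.stepAux q v (update T k (l ++ T k)) := by
  induction l generalizing q with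
  | nil => rw [pushAll, List.foldl_nil, List.nil_append, update_eq_self]
  | cons a l ih =>
    rw [pushAll, List.foldl_cons]
    refine (ih _).trans ?_
    rw [TM2.stepAux, update_self, update_idem, List.cons_append]

end PushAll

section FoldMachine

open Turing Turing.PartrecToTM2

/-- The stacks of a fold machine that are not used by the evaluator. -/
inductive Port
  | input
  | output
  deriving DecidableEq

instance : Fintype Port :=
  ⟨{.input, .output}, fun p => by cases p <;> simp⟩

/-- The labels of a fold machine outside of the evaluator. The argument of `call` is the symbol
that has been read, or `none` at the end of the input. -/
inductive Control (α : Type)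
  | start
  | read
  | call (x : Option α)
  | finish
  deriving Fintype

/-- The alphabets of the input and of the output stack. -/
abbrev PortAlphabet (α : Type) : Port → Type
  | .input => α
  | .output => Bool

/-- The alphabets of all stacks of a fold machine that reads words over `α`. -/
abbrev FoldAlphabet (α : Type) : K' ⊕ Port → Type :=
  Sum.elim (fun _ => Γ') (PortAlphabet α)

/-- The contents of the input and of the output stack. -/
abbrev portStacks {α : Type} (i : List α) (o : List Bool) : ∀ p, List (PortAlphabet α p)
  | .input => i
  | .output => o

variable {α σ : Type} (S : Finset Λ')

/-- The label of a fold machine that stands for the label `q` of the evaluator. -/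
def evaluatorLabel (q : Λ') : S ⊕ Control α :=
  (restrictLabel S q).elim (.inr .start) .inl

/-- Where a fold machine continues once the evaluator has processed what was read. -/
def returnLabel (x : Option α) : S ⊕ Control α :=
  x.elim (.inr .finish) fun _ => .inr .read

/-- The configurations of a fold machine, as far as they occur between two evaluations. -/
abbrev foldCfg (l : Option (S ⊕ Control α)) (x : Option α) (m : List Γ') (i : List α)
    (o : List Bool) :
    TM2.Cfg (FoldAlphabet α) (S ⊕ Control α) (Option Γ' × Option α) :=
  ⟨l, (none, x), joinStacks (K'.elim m [] [] []) (portStacks i o)⟩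

theorem stepAux_pushAll_main {Λ τ : Type} (l m : List Γ') (q : TM2.Stmt (FoldAlphabet α) Λ τ)
    (v : τ) (U : ∀ p, List (PortAlphabet α p)) :
    TM2.stepAux (pushAll (Γ := FoldAlphabet α) (.inl .main) l q) v
        (joinStacks (K'.elim m [] [] []) U) =
      TM2.stepAux q v (joinStacks (K'.elim (l ++ m) [] [] []) U) := by
  refine (stepAux_pushAll (Γ := FoldAlphabet α) (.inl .main) l q v _).trans
    (congrArg (TM2.stepAux q v) ?_)
  exact (update_joinStacks_inl _ U _ _).trans (congrArg (joinStacks · U) K'.elim_update_main)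

theorem update_portStacks_input (i i' : List α) (o : List Bool) :
    update (portStacks i o) .input i' = portStacks i' o := by
  funext p
  cases p <;> rfl

variable [Primcodable α] [Primcodable σ] (q₀ : Λ') (s₀ : ℕ)

/-- The fold machine: the stack `main` holds the code of the current state; whenever a symbol, or
the end of the input, has been read, its code is put on top and the evaluator is called, which
leaves the code of the next state, or `0` or `1` as the answer. -/
def foldProgram :
    S ⊕ Control α → TM2.Stmt (FoldAlphabet α) (S ⊕ Control α) (Option Γ' × Option α)
  | .inl q => embedStmt (evaluatorLabel S) (returnLabel S) (tr q)
  | .inr .start => pushAll (Γ := FoldAlphabet α) (.inl .main) (trList [s₀])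
      (.goto fun _ => .inr .read)
  | .inr .read => .pop (.inr .input) (fun v a => (v.1, a)) (.goto fun v => .inr (.call v.2))
  | .inr (.call x) => pushAll (Γ := FoldAlphabet α) (.inl .main)
      (trNat (Encodable.encode x) ++ [Γ'.cons]) (.goto fun _ => evaluatorLabel S q₀)
  | .inr .finish => .pop (.inl .main) (fun v d => (d, v.2))
      (.push (.inr .output) (fun v => decide (v.1 = some Γ'.bit1))
        (.pop (.inl .main) (fun _ _ => (none, none)) .halt))

theorem step_start (i : List α) :
    TM2.step (foldProgram S q₀ s₀) (foldCfg S (some (.inr .start)) none [] i []) =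
      some (foldCfg S (some (.inr .read)) none (trList [s₀]) i []) := by
  refine congrArg some ((stepAux_pushAll_main _ _ _ _ _).trans (congrArg (TM2.Cfg.mk _ _) ?_))
  exact congrArg (fun m => joinStacks (K'.elim m [] [] []) _) (List.append_nil _)

theorem step_read (x : Option α) (m : List Γ') (i : List α) :
    TM2.step (foldProgram S q₀ s₀) (foldCfg S (some (.inr .read)) x m i []) =
      some (foldCfg S (some (.inr (.call i.head?))) i.head? m i.tail []) := by
  refine congrArg some (congrArg (TM2.Cfg.mk _ _) ?_)
  exact (update_joinStacks_inr _ _ _ _).trans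
    (congrArg (joinStacks _) (update_portStacks_input i i.tail []))

theorem step_call (x : Option α) (n : ℕ) (i : List α) :
    TM2.step (foldProgram S q₀ s₀) (foldCfg S (some (.inr (.call x))) x (trList [n]) i []) =
      some (embedCfg (evaluatorLabel S) (returnLabel S) x (portStacks i [])
        (evaluatorInit q₀ [Encodable.encode x, n])) := by
  refine congrArg some ((stepAux_pushAll_main _ _ _ _ _).trans (congrArg (TM2.Cfg.mk _ _) ?_))
  exact congrArg (fun m => joinStacks (K'.elim m [] [] []) _) (List.append_assoc _ _ _)

theorem step_finish (x : Option α) (b : Bool) :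
    TM2.step (foldProgram S q₀ s₀) (foldCfg S (some (.inr .finish)) x (trList [b.toNat]) [] []) =
      some (foldCfg S none none [] [] [b]) := by
  refine congrArg some (congrArg (TM2.Cfg.mk none (none, none)) ?_)
  funext k
  rcases b <;> rcases k with (_ | _ | _ | _) | _ | _ <;> rfl

variable {S} {q₀} {f : Option α → σ → ℕ} {t : Option α → σ → ℕ}

theorem stepsTo_evaluate (hq₀ : q₀ ∈ S) (hS : ∀ q ∈ S, TM2.SupportsStmt S (tr q))
    (ht : ∀ x s, StepsTo (TM2.step tr) (t x s)
      (evaluatorInit q₀ [Encodable.encode x, Encodable.encode s]) (PartrecToTM2.halt [f x s]))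
    (x : Option α) (s : σ) (i : List α) :
    StepsTo (TM2.step (foldProgram S q₀ s₀)) (t i.head? s + 2)
      (foldCfg S (some (.inr .read)) x (trList [Encodable.encode s]) i [])
      (foldCfg S (some (returnLabel S i.head?)) i.head? (trList [f i.head? s]) i.tail []) := by
  have hlabel : ∀ q ∈ S, foldProgram S q₀ s₀ (evaluatorLabel (α := α) S q) =
      embedStmt (evaluatorLabel S) (returnLabel S) (tr q) := fun q hq => by
    rw [evaluatorLabel, restrictLabel_of_mem S hq]
    rfl
  have hrun := stepsTo_embedCfg hS hlabel i.head? (portStacks i.tail [])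
    (Finset.some_mem_insertNone.2 hq₀) (ht i.head? s)
  exact .head (step_read S q₀ s₀ x _ i) (.head (step_call S q₀ s₀ i.head? _ i.tail) hrun)

/-- The function that the evaluator of a fold machine computes: the code of the next state, or
the answer at the end of the input. -/
def foldStep (δ : σ → α → σ) (accept : σ → Bool) (x : Option α) (s : σ) : ℕ :=
  x.elim (accept s).toNat fun a => Encodable.encode (δ s a)

variable {δ : σ → α → σ} {accept : σ → Bool}

theorem exists_stepsTo_of_read (hq₀ : q₀ ∈ S) (hS : ∀ q ∈ S, TM2.SupportsStmt S (tr q))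
    (ht : ∀ x s, StepsTo (TM2.step tr) (t x s)
      (evaluatorInit q₀ [Encodable.encode x, Encodable.encode s])
      (PartrecToTM2.halt [foldStep δ accept x s]))
    {B : ℕ} (w : List α) (y : Option α) (s : σ)
    (hB : ∀ u, u <+: w → ∀ x, t x (u.foldl δ s) ≤ B) :
    ∃ n ≤ (B + 2) * (w.length + 1) + 1, StepsTo (TM2.step (foldProgram S q₀ s₀)) n
      (foldCfg S (some (.inr .read)) y (trList [Encodable.encode s]) w [])
      (foldCfg S none none [] [] [accept (w.foldl δ s)]) := by
  have htB (x : Option α) : t x s ≤ B := hB [] List.nil_prefix x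
  have heval := stepsTo_evaluate s₀ hq₀ hS ht y s w
  induction w generalizing s y with
  | nil =>
    refine ⟨1 + (t none s + 2), ?_, heval.trans (.single (step_finish S q₀ s₀ none (accept s)))⟩
    have := htB none
    simp only [List.length_nil]
    omega
  | cons a w ih =>
    obtain ⟨n, hn, hrun⟩ := ih (some a) (δ s a)
      (fun u hu => hB (a :: u) (List.cons_prefix_cons.2 ⟨rfl, hu⟩))
      (hB [a] (List.cons_prefix_cons.2 ⟨rfl, List.nil_prefix⟩))
      (stepsTo_evaluate s₀ hq₀ hS ht (some a) (δ s a) w)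
    refine ⟨n + (t (some a) s + 2), ?_, heval.trans hrun⟩
    have := htB (some a)
    rw [List.length_cons, Nat.mul_succ]
    omega

variable (S q₀) in
/-- The fold machine in bundled form. -/
noncomputable def foldMachine [Fintype α] : TM2ComputableAux α Bool where
  tm :=
    { K := K' ⊕ Port
      k₀ := .inr .input
      k₁ := .inr .output
      Γ := FoldAlphabet α
      Λ := S ⊕ Control α
      main := .inr .start
      σ := Option Γ' × Option α
      initialState := (none, none)
      Γk₀Fin := inferInstanceAs (Fintype α)
      m := foldProgram S q₀ s₀ }
  inputAlphabet := Equiv.refl α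
  outputAlphabet := Equiv.refl Bool

section

variable [Fintype α]

theorem initList_foldMachine (w : List α) :
    initList (foldMachine S q₀ s₀).tm w = foldCfg S (some (.inr .start)) none [] w [] := by
  refine congrArg (TM2.Cfg.mk _ _) ?_
  funext k
  rcases k with (_ | _ | _ | _) | _ | _ <;> rfl

theorem haltList_foldMachine (o : List Bool) :
    haltList (foldMachine (α := α) S q₀ s₀).tm o = foldCfg S none none [] [] o := by
  refine congrArg (TM2.Cfg.mk _ _) ?_
  funext k
  rcases k with (_ | _ | _ | _) | _ | _ <;> rfl

end

theorem computable₂_foldStep (hδ : Computable₂ δ) (haccept : Computable accept) :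
    Computable₂ (foldStep δ accept) := by
  have hnext : Computable₂ fun (p : Option α × σ) (a : α) => Encodable.encode (δ p.2 a) :=
    Computable.encode.comp (hδ.comp (Computable.snd.comp Computable.fst) Computable.snd)
  have hanswer : Computable fun p : Option α × σ => (accept p.2).toNat :=
    (Primrec.dom_bool Bool.toNat).to_comp.comp (haccept.comp Computable.snd)
  refine (Computable.option_casesOn Computable.fst hanswer hnext).of_eq ?_
  rintro ⟨_ | a, s⟩ <;> rfl

theorem exists_foldMachine [Finite α] (hδ : Computable₂ δ) (haccept : Computable accept)
    (s₀ : σ) :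
    ∃ (M : TM2ComputableAux α Bool) (t : Option α → σ → ℕ),
      (∀ k, Finite (M.tm.Γ k)) ∧ Computable₂ t ∧ ∀ (w : List α) (B : ℕ),
        (∀ u, u <+: w → ∀ x, t x (u.foldl δ s₀) ≤ B) →
        Nonempty (TM2OutputsInTime M.tm (w.map M.inputAlphabet.symm)
          (some ([accept (w.foldl δ s₀)].map M.outputAlphabet.symm))
          ((B + 4) * (w.length + 1))) := by
  have := Fintype.ofFinite α
  obtain ⟨S, q₀, t, hq₀, hS, htc, ht⟩ :=
    exists_evaluator (computable₂_foldStep hδ haccept)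
  refine ⟨foldMachine S q₀ (Encodable.encode s₀), t, ?_, htc, fun w B hB => ?_⟩
  · rintro (_ | _ | _)
    · exact inferInstanceAs (Finite Γ')
    · exact inferInstanceAs (Finite α)
    · exact inferInstanceAs (Finite Bool)
  · obtain ⟨n, hn, hrun⟩ := exists_stepsTo_of_read (Encodable.encode s₀) hq₀ hS ht w none s₀ hB
    have hw : w.map (foldMachine S q₀ (Encodable.encode s₀)).inputAlphabet.symm = w :=
      List.map_id w
    have hstart := hrun.head (step_start S q₀ (Encodable.encode s₀) w)
    rw [← initList_foldMachine (q₀ := q₀) (Encodable.encode s₀),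
      ← haltList_foldMachine (q₀ := q₀) (Encodable.encode s₀)] at hstart
    rw [hw]
    refine ⟨⟨⟨n + 1, hstart⟩, ?_⟩⟩
    change n + 1 ≤ _
    rw [add_mul] at hn ⊢
    omega

end FoldMachine

namespace ParamProblem

/-- Each of the transitions takes an amount of time that is bounded in terms of the parameter,
because only finitely many states occur for each value of the parameter. -/
theorem inFPT_of_foldl (P : ParamProblem) {σ : Type} [Finite P.Sym] [Primcodable P.Sym]
    [Primcodable σ] {δ : σ → P.Sym → σ} {accept : σ → Bool} {s₀ : σ} {states : ℕ → List σ}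
    (hδ : Computable₂ δ) (haccept : Computable accept) (hstates : Computable states)
    (hmem : ∀ x u, u <+: P.encode x → u.foldl δ s₀ ∈ states (P.param x))
    (hyes : ∀ x, accept ((P.encode x).foldl δ s₀) = true ↔ P.Yes x) : P.InFPT := by
  have := Fintype.ofFinite P.Sym
  obtain ⟨M, t, hfin, ht, hM⟩ := exists_foldMachine hδ haccept s₀
  let reads : List (Option P.Sym) := Finset.univ.toList
  let bound (k : ℕ) : ℕ := ((states k).map fun s => (reads.map fun x => t x s).sum).sum
  have hsum : Computable₂ fun (_ : ℕ) s => (reads.map fun x => t x s).sum :=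
    computable_list_sum_map (.const reads)
      (ht.comp Computable.snd (Computable.snd.comp Computable.fst)).to₂
  have hbound : Computable bound := computable_list_sum_map hstates hsum
  have ht_le (k : ℕ) (s : σ) (hs : s ∈ states k) (x : Option P.Sym) : t x s ≤ bound k :=
    calc t x s ≤ (reads.map fun x => t x s).sum :=
          List.le_sum_of_mem (List.mem_map_of_mem (Finset.mem_toList.2 (Finset.mem_univ x)))
      _ ≤ bound k := List.le_sum_of_mem (List.mem_map_of_mem hs)
  refine ⟨M, fun k => bound k + 4, Polynomial.X + 1, hfin,
    Primrec.nat_add.to_comp.comp hbound (.const 4), fun x => ⟨_, hyes x, ?_⟩⟩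
  rw [Polynomial.eval_add, Polynomial.eval_X, Polynomial.eval_one]
  exact hM (P.encode x) (bound (P.param x)) fun u hu y => ht_le _ _ (hmem x u hu) y

end ParamProblem

theorem theorem5 (𝓕 𝒢 : Set FinGraph)
    (h_decidable : FinGraph.DecidableMembership 𝒢)
    (h_induced : FinGraph.ClosedUnderInducedSubgraphs 𝒢)
    (h_union : FinGraph.ClosedUnderDisjointUnions 𝒢)
    (h_connected : ∀ F ∈ 𝓕, F.graph.Connected) :
    (pSingleHomRec 𝓕 𝒢).InFPT := by
  obtain ⟨D, hD, hD_iff⟩ := FinGraph.exists_computable_homValues h_decidable h_induced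
  have haccept : Computable fun s : List Bool × ℕ × ℕ => D s.1 s.2.2 :=
    hD.comp Computable.fst (Computable.snd.comp Computable.snd)
  have : Finite (pSingleHomRec 𝓕 𝒢).Sym := inferInstanceAs (Finite (Bool ⊕ Bool))
  let _ : Primcodable (pSingleHomRec 𝓕 𝒢).Sym := inferInstanceAs (Primcodable (Bool ⊕ Bool))
  refine (pSingleHomRec 𝓕 𝒢).inFPT_of_foldl (s₀ := ([], 1, 0)) FinGraph.primrec_readSymbol.to_comp
    haccept FinGraph.primrec_readStates.to_comp
    (fun _ _ hu => FinGraph.foldl_readSymbol_mem_readStates hu) ?_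
  rintro ⟨⟨F, h⟩, hF⟩
  obtain ⟨x, hx⟩ := FinGraph.foldl_readSymbol_encodeWithNumber F h
  have hperiodic (n : ℕ) (hn : FinGraph.threshold F.order ≤ n) :
      n + FinGraph.period F.order ∈ F.homValues 𝒢 ↔ n ∈ F.homValues 𝒢 :=
    FinGraph.add_period_mem_homValues_iff (h_connected F hF) h_induced h_union hn
  calc D _ _ = true
    _ ↔ D F.encode (eventualMod _ _ h) = true :=
      iff_of_eq (congrArg (fun s : List Bool × ℕ × ℕ => D s.1 s.2.2 = true) hx)
    _ ↔ eventualMod _ _ h ∈ F.homValues 𝒢 := hD_iff F _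
    _ ↔ h ∈ F.homValues 𝒢 := eventualMod_mem_iff hperiodic h
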